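/- **Setting.** Let $n\ge 2$, $0<\delta<R$, let $K\subset\mathbb R^n$ be convex with $0$ in its interior and $K\subseteq B(0,R)$, and let $p\ne 0$ with $\|p\|\le R$. Here $B(x,t)$ is the closed Euclidean ball, $S(K,t)=\bigcup_{x\in K}B(x,t)$, and $r:=2\delta/(5R)$, $\epsilon:=\delta/5$, $\delta':=2\delta/5$, $\tilde\delta:=\delta/(5R)$. Put $M_p=\{c:\|c\|=1,\ c^Tk<c^Tp\ \forall k\in K\}$, $M_p'=\{c:\|c\|=1,\ c^Tk+\delta'<c^Tp\ \forall k\in S(K,\epsilon)\}$, $K_p=\mathrm{conv}(M_p\cup\{0\})\setminus\{0\}$ and $K_p'=\mathrm{conv}(M_p'\cup\{0\})\setminus\{0\}$. For finitely many hyperplanes $(a_i,b_i)$, $1\le i\le h$, let $P=\{x:\|x\|\le 1,\ a_i^Tx\ge b_i\ \forall i\}$ and $F(x)=-\sum_i\log(a_i^Tx-b_i)-\log(1-x^Tx)$ on the interior region where all these inequalities are strict. Let $\lambda(x)=\sqrt{\nabla F(x)^T(\nabla^2F(x))^{-1}\nabla F(x)}$, $\sigma_i(x)=a_i^T(\nabla^2F(x))^{-1}a_i/(a_i^Tx-b_i)^2$,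 $q_t=1-(1-3t)^{1/3}$ and $E(A,z,\vartheta)=\{x:(x-z)^TA(x-z)\le\vartheta^2\}$. **Algorithm.** The constants are $\rho_0\in(0,1/3)$, $\sigma_0>0$, $\gamma_0>0$ such that $\zeta_0:=q_{\rho_0}<1/16$, $\zeta_0\gamma_0<1$ and $\gamma_0/((1-\zeta_0\gamma_0)(1-\zeta_0))<1/3$. The algorithm keeps hyperplanes $(a_i,b_i)$, numbers $\kappa_i$ and a point $z$, and $\mu_i(z):=(a_i^Tz-b_i)/\kappa_i$. It starts with the single hyperplane $(p/\|p\|,0)$, $z=p/(\sqrt3\|p\|)$, $\kappa_1=1/\sqrt3$. "Recentre" means: replace $z$ by any point $x$ at which all inequalities that define the new region hold strictly and such that (for the new $F$) $\lambda(x)<\rho_0$ and $q_{\lambda(x)}<\frac{\tilde\delta}{1+\tilde\delta}\frac{\|x\|}{\sqrt2}$. One iteration is as follows. * If $\mu_j(z)>2$ and $\sigma_j(z)<\sigma_0$ for some $j$: discard such a hyperplane $(a_j,b_j)$ and recentre. * Otherwise, if $\mu_j(z)>2$ for some $j$: for one such $j$ reset $\kappa_j:=a_j^Tz-b_j$. *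 Otherwise: put $c=z/\|z\|$ and ask the weak optimisation oracle for a point $k\in S(K,\epsilon)$ with $c^Tx\le c^Tk+\epsilon$ for all $x\in K$. If $c^Tp\ge c^Tk+\delta/5$, return $c$. If not, let $a$ be the normalisation of $(p-k)-c^T(p-k)\,c$, which is required to be non-zero, choose $\beta<0$ with $a^T(\nabla^2F(z))^{-1}a/(a^Tz-\beta)^2=\gamma_0^2$, add the hyperplane $(a,\beta)$, recentre to a new $z$, and set $\kappa(a,\beta):=a^Tz-\beta$ for this new $z$. All computations are exact. The loop is left as soon as $h\ge\nu n u$ (Stopping Condition 1), where $h$ is the current number of hyperplanes; no other stopping test is imposed. **Theorem.** There is a function $u=u(n,R,\delta)$ with $u=\Theta(\log n+\log(R/\delta))$ uniformly for $n\ge2$, $0<\delta<R$ (so $u$ lies between positive polynomial expressions in $n$ and $\log(R/\delta)$), and for all constants $\rho_0,\sigma_0,\gamma_0$ as above there is a constant $\nu>0$, independent of $h,n,R,\delta,K,p$, such that the following holds for all $n,R,\delta,K,p$ as above. 1. If $p\notin S(K,\delta)$, then $\mathrm{vol}(K_p')\ge (r/n)^n$ and $\mathrm{vol}(K_p)\ge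 (r/n)^n$. 2. Whenever the algorithm, for any valid oracle answers and any admissible choices, reaches a state with $h\ge\nu n u$, the current region $P$ and point $z$ satisfy $$P\subseteq E(\nabla^2F(z),z,6h),\qquad \mathrm{vol}(P)<\left(\frac rn\right)^n,\qquad K_p'\subseteq P,$$ and $p\in S(K,\delta)$. So the algorithm may correctly assert $p\in S(K,\delta)$. -/

import Mathlib

open MeasureTheory
open scoped Matrix

noncomputable section

namespace CuttingPlane

/-! ### Convex bodies, the target set, ellipsoids -/

/-- Euclidean `n`-space. -/
abbrev Vec (n : ℕ) : Type := EuclideanSpace ℝ (Fin n)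

/-- `S(K, δ)`: the union of the closed balls of radius `δ` with centre in `K`. -/
def nbhd {n : ℕ} (K : Set (Vec n)) (δ : ℝ) : Set (Vec n) :=
  ⋃ x ∈ K, Metric.closedBall x δ

/-- `M_p`: the unit vectors `c` with `cᵀk < cᵀp` for every `k ∈ K`. -/
def sepDirs {n : ℕ} (K : Set (Vec n)) (p : Vec n) : Set (Vec n) :=
  {c | ‖c‖ = 1 ∧ ∀ k ∈ K, inner ℝ c k < inner ℝ c p}

/-- `K_p`: the convex hull of `M_p` and the origin, with the origin removed. -/
def sepCone {n : ℕ} (K : Set (Vec n)) (p : Vec n) : Set (Vec n) :=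
  convexHull ℝ (sepDirs K p ∪ {0}) \ {0}

/-- `M_p'`: the unit vectors `c` with `cᵀk + δ' < cᵀp` for every `k ∈ S(K, ε)`,
where `δ' = 2δ/5` and `ε = δ/5`. -/
def robustSepDirs {n : ℕ} (K : Set (Vec n)) (p : Vec n) (δ : ℝ) : Set (Vec n) :=
  {c | ‖c‖ = 1 ∧ ∀ k ∈ nbhd K (δ / 5), inner ℝ c k + 2 * δ / 5 < inner ℝ c p}

/-- `K_p'`: the convex hull of `M_p'` and the origin, with the origin removed. -/
def robustSepCone {n : ℕ} (K : Set (Vec n)) (p : Vec n) (δ : ℝ) : Set (Vec n) :=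
  convexHull ℝ (robustSepDirs K p δ ∪ {0}) \ {0}

/-- `r = 2δ/(5R)`. -/
def innerRadius (R δ : ℝ) : ℝ := 2 * δ / (5 * R)

/-- A valid answer `y` of the weak optimisation oracle for `K` to the query `(c, ε)`. -/
def IsWOptAnswer {n : ℕ} (K : Set (Vec n)) (c : Vec n) (ε : ℝ) (y : Vec n) : Prop :=
  y ∈ nbhd K ε ∧ ∀ x ∈ K, inner ℝ c x ≤ inner ℝ c y + ε

/-- The quadratic form `vᵀ A v`. -/
def quad {n : ℕ} (A : Matrix (Fin n) (Fin n) ℝ) (v : Vec n) : ℝ :=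
  v.ofLp ⬝ᵥ (A *ᵥ v.ofLp)

/-- `E(A, z, ϑ) = {x : (x - z)ᵀ A (x - z) ≤ ϑ²}`. -/
def ellipsoid {n : ℕ} (A : Matrix (Fin n) (Fin n) ℝ) (z : Vec n) (ϑ : ℝ) : Set (Vec n) :=
  {x | quad A (x - z) ≤ ϑ ^ 2}

/-! ### Search regions and their barrier function -/

/-- A finite set of labelled hyperplanes `(aᵢ, bᵢ)`, `i ∈ idx`. The values of `a` and `b` at labels
outside `idx` play no role. -/
structure Cuts (n : ℕ) where
  /-- the labels in use -/
  idx : Finset ℕ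
  /-- the normal vectors -/
  a : ℕ → Vec n
  /-- the offsets -/
  b : ℕ → ℝ

namespace Cuts

variable {n : ℕ} (S : Cuts n)

/-- The number `h` of hyperplanes. -/
def h : ℕ := S.idx.card

/-- The search region `P`: the points `x` of the closed unit ball with `aᵢᵀx ≥ bᵢ` for all `i`. -/
def region : Set (Vec n) :=
  {x | ‖x‖ ≤ 1 ∧ ∀ i ∈ S.idx, S.b i ≤ inner ℝ (S.a i) x}

/-- The domain of the barrier: all the inequalities that define `P` hold strictly. -/
def domain : Set (Vec n) :=
  {x | ‖x‖ < 1 ∧ ∀ i ∈ S.idx, S.b i < inner ℝ (S.a i) x}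

/-- `aᵢᵀx - bᵢ`. -/
def slack (i : ℕ) (x : Vec n) : ℝ := inner ℝ (S.a i) x - S.b i

/-- `F(x) = - ∑ log (aᵢᵀx - bᵢ) - log (1 - xᵀx)`. -/
def barrier (x : Vec n) : ℝ :=
  -∑ i ∈ S.idx, Real.log (S.slack i x) - Real.log (1 - ‖x‖ ^ 2)

/-- The gradient `∇F(x)`; see `hasGradientAt_barrier`. -/
def grad (x : Vec n) : Vec n :=
  -∑ i ∈ S.idx, (S.slack i x)⁻¹ • S.a i + (2 / (1 - ‖x‖ ^ 2)) • x

/-- The Hessian matrix `∇²F(x)`; see `hasFDerivAt_grad`. -/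
def hess (x : Vec n) : Matrix (Fin n) (Fin n) ℝ :=
  ∑ i ∈ S.idx, ((S.slack i x) ^ 2)⁻¹ • Matrix.vecMulVec (S.a i).ofLp (S.a i).ofLp
    + (4 / (1 - ‖x‖ ^ 2) ^ 2) • Matrix.vecMulVec x.ofLp x.ofLp
    + (2 / (1 - ‖x‖ ^ 2)) • (1 : Matrix (Fin n) (Fin n) ℝ)

/-- `λ(x) = √(∇F(x)ᵀ (∇²F(x))⁻¹ ∇F(x))`. -/
def newtonDecrement (x : Vec n) : ℝ := Real.sqrt (quad (S.hess x)⁻¹ (S.grad x))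

/-- `σᵢ(x) = aᵢᵀ (∇²F(x))⁻¹ aᵢ / (aᵢᵀx - bᵢ)²`. -/
def sigma (i : ℕ) (x : Vec n) : ℝ := quad (S.hess x)⁻¹ (S.a i) / (S.slack i x) ^ 2

/-- Discard the hyperplane with label `j`. -/
def discard (j : ℕ) : Cuts n where
  idx := S.idx.erase j
  a := S.a
  b := S.b

/-- Add the hyperplane `(v, β)` under the label `j`. -/
def add (j : ℕ) (v : Vec n) (β : ℝ) : Cuts n where
  idx := insert j S.idx
  a := Function.update S.a j v
  b := Function.update S.b j β

theorem one_sub_norm_sq_pos {x : Vec n} (hx : x ∈ S.domain) : 0 < 1 - ‖x‖ ^ 2 := by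
  have h1 := hx.1
  have h0 := norm_nonneg x
  nlinarith

theorem slack_pos {x : Vec n} (hx : x ∈ S.domain) {i : ℕ} (hi : i ∈ S.idx) : 0 < S.slack i x := by
  have := hx.2 i hi
  unfold slack
  linarith

theorem hasFDerivAt_slack (i : ℕ) (x : Vec n) :
    HasFDerivAt (S.slack i) (innerSL ℝ (S.a i)) x := by
  exact ((innerSL ℝ (S.a i)).hasFDerivAt (x := x)).sub_const (S.b i)

theorem hasFDerivAt_one_sub_norm_sq (x : Vec n) :
    HasFDerivAt (fun y : Vec n => 1 - ‖y‖ ^ 2) (-((2 : ℝ) • innerSL ℝ x)) x := by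
  refine ((hasStrictFDerivAt_norm_sq x).hasFDerivAt.const_sub (1 : ℝ)).congr_fderiv ?_
  ext v
  simp

theorem hasGradientAt_barrier {x : Vec n} (hx : x ∈ S.domain) :
    HasGradientAt S.barrier (S.grad x) x := by
  rw [hasGradientAt_iff_hasFDerivAt]
  have hs : HasFDerivAt (fun y => ∑ i ∈ S.idx, Real.log (S.slack i y))
      (∑ i ∈ S.idx, (S.slack i x)⁻¹ • innerSL ℝ (S.a i)) x :=
    HasFDerivAt.fun_sum fun i hi => (S.hasFDerivAt_slack i x).log (S.slack_pos hx hi).ne'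
  have hb := (hasFDerivAt_one_sub_norm_sq x).log (S.one_sub_norm_sq_pos hx).ne'
  refine (hs.neg.sub hb).congr_fderiv ?_
  ext v
  simp [grad, sum_apply]
  ring

theorem hasFDerivAt_grad {x : Vec n} (hx : x ∈ S.domain) :
    HasFDerivAt S.grad (Matrix.toEuclideanCLM (𝕜 := ℝ) (S.hess x)) x := by
  have hs : HasFDerivAt (fun y => ∑ i ∈ S.idx, (S.slack i y)⁻¹ • S.a i)
      (∑ i ∈ S.idx, ((-((S.slack i x) ^ 2)⁻¹) • innerSL ℝ (S.a i)).smulRight (S.a i)) x :=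
    HasFDerivAt.fun_sum fun i hi =>
      ((hasDerivAt_inv (S.slack_pos hx hi).ne').comp_hasFDerivAt x
        (S.hasFDerivAt_slack i x)).smul_const (S.a i)
  have hb := (((hasDerivAt_inv (S.one_sub_norm_sq_pos hx).ne').comp_hasFDerivAt x
    (hasFDerivAt_one_sub_norm_sq x)).const_mul 2).smul (hasFDerivAt_id x)
  refine (hs.neg.add hb).congr_fderiv ?_
  ext v j
  have key : ∀ w : Vec n, w.ofLp ⬝ᵥ v.ofLp = inner ℝ w v := fun w => by
    rw [EuclideanSpace.inner_eq_star_dotProduct, dotProduct_comm]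
    simp
  simp [hess, Matrix.vecMulVec_mulVec, key, sum_apply, Finset.sum_apply]
  have h0 := (S.one_sub_norm_sq_pos hx).ne'
  field_simp
  ring

end Cuts

/-- `q_t = 1 - (1 - 3t)^(1/3)`, for `t ≤ 1/3`. -/
def qFun (t : ℝ) : ℝ := 1 - (1 - 3 * t) ^ (1 / 3 : ℝ)

/-- `γ̃ = γ / ((1 - ζγ)(1 - ζ))`. -/
def gammaTilde (γ ζ : ℝ) : ℝ := γ / ((1 - ζ * γ) * (1 - ζ))

/-! ### The algorithm -/

/-- The constants `ρ₀`, `σ₀`, `γ₀` of the algorithm, with the restrictions that the volume argument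
puts on them; `ζ₀` is `q_{ρ₀}`. -/
structure Constants where
  ρ₀ : ℝ
  σ₀ : ℝ
  γ₀ : ℝ
  ρ₀_pos : 0 < ρ₀
  ρ₀_lt : ρ₀ < 1 / 3
  ζ₀_lt : qFun ρ₀ < 1 / 16
  σ₀_pos : 0 < σ₀
  γ₀_pos : 0 < γ₀
  ζ₀_mul_γ₀_lt : qFun ρ₀ * γ₀ < 1
  gammaTilde_lt : gammaTilde γ₀ (qFun ρ₀) < 1 / 3

/-- The termination test of the Newton iteration for the hyperplanes `S`: `x` lies in the interior
of the region, `λ(x) < ρ₀`, and `q_{λ(x)} < (δ̃ / (1 + δ̃)) ‖x‖ / √2`, where `δ̃ = δ/(5R)`. -/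
def IsApproxCentre {n : ℕ} (C : Constants) (R δ : ℝ) (S : Cuts n) (x : Vec n) : Prop :=
  x ∈ S.domain ∧ S.newtonDecrement x < C.ρ₀ ∧
    qFun (S.newtonDecrement x) < (δ / (5 * R)) / (1 + δ / (5 * R)) * (‖x‖ / Real.sqrt 2)

/-- The data that the algorithm keeps: the hyperplanes, the reference distances `κ(aᵢ, bᵢ)` and the
current approximate analytic centre `z`. -/
structure State (n : ℕ) where
  cuts : Cuts n
  κ : ℕ → ℝ
  z : Vec n

/-- `μᵢ(z) = (aᵢᵀz - bᵢ) / κ(aᵢ, bᵢ)`. -/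
def State.mu {n : ℕ} (s : State n) (i : ℕ) : ℝ := s.cuts.slack i s.z / s.κ i

/-- The initial state: the only hyperplane is `(p/‖p‖, 0)`, `z = a₁/√3` and `κ(a₁, b₁) = 1/√3`. -/
def initState {n : ℕ} (p : Vec n) : State n where
  cuts := { idx := {0}, a := fun _ => ‖p‖⁻¹ • p, b := fun _ => 0 }
  κ := fun _ => 1 / Real.sqrt 3
  z := (1 / Real.sqrt 3) • (‖p‖⁻¹ • p)

/-- The test vector `c = z/‖z‖`. -/
def State.query {n : ℕ} (s : State n) : Vec n := ‖s.z‖⁻¹ • s.z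

/-- `(p - k) - cᵀ(p - k) c`. -/
def cutNormal {n : ℕ} (p k c : Vec n) : Vec n := (p - k) - (inner ℝ c (p - k) : ℝ) • c

/-- One pass through the body of the loop that does not return a separating vector. Any valid answer
of the oracle is allowed, and so is any point that passes the termination test of the Newton
iteration. -/
inductive Step {n : ℕ} (C : Constants) (K : Set (Vec n)) (R δ : ℝ) (p : Vec n) :
    State n → State n → Prop
  /-- Subcase 1.1: a hyperplane with `μⱼ(z) > 2` and `σⱼ(z) < σ₀` is discarded. -/
  | discard (s : State n) (j : ℕ) (z' : Vec n)
      (hj : j ∈ s.cuts.idx) (hμ : 2 < s.mu j) (hσ : s.cuts.sigma j s.z < C.σ₀)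
      (hz' : IsApproxCentre C R δ (s.cuts.discard j) z') :
      Step C K R δ p s { cuts := s.cuts.discard j, κ := s.κ, z := z' }
  /-- Subcase 1.2: no hyperplane can be discarded, and `κ(aⱼ, bⱼ)` is reset for some `j` with
  `μⱼ(z) > 2`. -/
  | reset (s : State n) (j : ℕ)
      (hno : ∀ i ∈ s.cuts.idx, 2 < s.mu i → C.σ₀ ≤ s.cuts.sigma i s.z)
      (hj : j ∈ s.cuts.idx) (hμ : 2 < s.mu j) :
      Step C K R δ p s
        { cuts := s.cuts, κ := Function.update s.κ j (s.cuts.slack j s.z), z := s.z }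
  /-- Case 2: all `μᵢ(z) ≤ 2`. The oracle is called on `c = z/‖z‖` with `ε = δ/5`; its answer `k` does
  not certify `c`, and the shallow cut `(a, β)` is added under a new label. -/
  | add (s : State n) (k a : Vec n) (β : ℝ) (j : ℕ) (z' : Vec n)
      (hμ : ∀ i ∈ s.cuts.idx, s.mu i ≤ 2)
      (hk : IsWOptAnswer K s.query (δ / 5) k)
      (hrej : ¬ (inner ℝ s.query k + δ / 5 ≤ inner ℝ s.query p))
      (hne : cutNormal p k s.query ≠ 0)
      (ha : a = ‖cutNormal p k s.query‖⁻¹ • cutNormal p k s.query)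
      (hβ : β < 0)
      (hγ : quad (s.cuts.hess s.z)⁻¹ a / (inner ℝ a s.z - β) ^ 2 = C.γ₀ ^ 2)
      (hj : j ∉ s.cuts.idx)
      (hz' : IsApproxCentre C R δ (s.cuts.add j a β) z') :
      Step C K R δ p s
        { cuts := s.cuts.add j a β, κ := Function.update s.κ j (inner ℝ a z' - β), z := z' }

/-- The states that the algorithm can reach if it halts as soon as `h ≥ H` (Stopping Condition 1 for
`H = ν n u`). No other stopping test interrupts the loop, so the states that are reached when the loop
has further stopping tests are among these. -/
inductive Reachable {n : ℕ} (C : Constants) (K : Set (Vec n)) (R δ : ℝ) (p : Vec n) (H : ℝ) :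
    State n → Prop
  | init : Reachable C K R δ p H (initState p)
  | step (s t : State n) (hs : Reachable C K R δ p H s) (hlt : (s.cuts.h : ℝ) < H)
      (hst : Step C K R δ p s t) : Reachable C K R δ p H t

end CuttingPlane

end

noncomputable section

namespace CuttingPlane

/-! ### Quadratic forms of positive definite matrices -/

section Quad

variable {n : ℕ}

/-! Two volume estimates collide. If `p ∉ S(K, δ)`, the projection of `p` onto the closure of `K`
gives a unit vector `c` separating with margin `δ`. A ball about `(4/5)c` then lies in `K_p'` and
contains a cube of side `r/n`, whence the lower bound (`le_volume_robustSepCone`). Since no cut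
removes a point of `K_p'`, a region of smaller volume forces `p ∈ S(K, δ)`.

Cuts preserve `K_p'` because all offsets are nonpositive and all normals have nonnegative inner
product with every `d ∈ M_p'`. For a new normal, `(p - k)ᵀd > 2δ/5`, and the correction along `c`
costs at most `δ/5`: an approximate centre cannot point far away from a `d` on which all normals are
nonnegative (`Cuts.neg_inner_mul_sqrt_two_le`).

For the upper bound, `1 - ‖x‖²` splits along a line into two linear factors, so `F` restricted to
the line is minus a sum of `h + 2` logarithms of linear functions. Gradient and Hessian along the
line become, up to sign, the sums of the relative changes `ξ` and of their squares. On `P` every `ξ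
≥ -1`; with a small Newton decrement this confines `P` to the ellipsoid of radius `6h`. When all `μᵢ
≤ 2`, the Hessian dominates a quarter of `I + ∑ aᵢaᵢᵀ/κᵢ²`. If the cuts are ordered by the time at
which `κᵢ` was last set, each multiplies the determinant of this matrix by at least `1 + c`
(`Growing`). Hence `vol P ≤ (24h)^n (1 + c)^(-h/2)`, which is below `(r/n)^n` once `h` is a large
multiple of `n u`. The threshold is first reached by adding a cut, so the estimate is applied to the
state just before, whose region contains the current one. -/

theorem dotProduct_ofLp_eq_inner (v w : Vec n) : v.ofLp ⬝ᵥ w.ofLp = inner ℝ v w := by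
  rw [EuclideanSpace.inner_eq_star_dotProduct, dotProduct_comm]
  simp

theorem quad_nonneg {A : Matrix (Fin n) (Fin n) ℝ} (hA : A.PosDef) (v : Vec n) :
    0 ≤ quad A v := by
  simpa [quad] using hA.posSemidef.dotProduct_mulVec_nonneg v.ofLp

theorem quad_pos {A : Matrix (Fin n) (Fin n) ℝ} (hA : A.PosDef) {v : Vec n} (hv : v ≠ 0) :
    0 < quad A v := by
  have h : v.ofLp ≠ 0 := fun h => hv (by ext i; simp [h])
  simpa [quad] using hA.dotProduct_mulVec_pos h

theorem quad_add_left (A B : Matrix (Fin n) (Fin n) ℝ) (v : Vec n) :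
    quad (A + B) v = quad A v + quad B v := by
  simp [quad, Matrix.add_mulVec]

theorem quad_smul_left (t : ℝ) (A : Matrix (Fin n) (Fin n) ℝ) (v : Vec n) :
    quad (t • A) v = t * quad A v := by
  simp [quad, Matrix.smul_mulVec]

theorem quad_one (v : Vec n) : quad 1 v = ‖v‖ ^ 2 := by
  rw [quad, Matrix.one_mulVec, dotProduct_ofLp_eq_inner, real_inner_self_eq_norm_sq]

theorem quad_vecMulVec (a v : Vec n) :
    quad (Matrix.vecMulVec a.ofLp a.ofLp) v = (inner ℝ a v) ^ 2 := by
  have h := dotProduct_ofLp_eq_inner a v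
  simp [quad, Matrix.vecMulVec_mulVec, dotProduct_smul, h]
  rw [dotProduct_comm, h]
  ring

theorem quad_sum {ι : Type*} (s : Finset ι) (A : ι → Matrix (Fin n) (Fin n) ℝ) (v : Vec n) :
    quad (∑ i ∈ s, A i) v = ∑ i ∈ s, quad (A i) v := by
  induction s using Finset.cons_induction with
  | empty => simp [quad]
  | cons i s hi ih => rw [Finset.sum_cons, Finset.sum_cons, quad_add_left, ih]

theorem mulVec_inv_mulVec {A : Matrix (Fin n) (Fin n) ℝ} (hA : A.PosDef) (g : Fin n → ℝ) :
    A *ᵥ (A⁻¹ *ᵥ g) = g := by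
  rw [Matrix.mulVec_mulVec, Matrix.mul_nonsing_inv A (isUnit_iff_ne_zero.2 hA.det_pos.ne'),
    Matrix.one_mulVec]

theorem quad_inv_mulVec {A : Matrix (Fin n) (Fin n) ℝ} (hA : A.PosDef) (g : Vec n) :
    quad A (WithLp.toLp 2 (A⁻¹ *ᵥ g.ofLp)) = quad A⁻¹ g := by
  simp only [quad]
  rw [mulVec_inv_mulVec hA, dotProduct_comm]

theorem inner_inv_mulVec {A : Matrix (Fin n) (Fin n) ℝ} (g : Vec n) :
    inner ℝ g (WithLp.toLp 2 (A⁻¹ *ᵥ g.ofLp)) = quad A⁻¹ g := by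
  rw [← dotProduct_ofLp_eq_inner, quad]

/-- Cauchy–Schwarz for dual pairs of quadratic forms. -/
theorem inner_sq_le_quad_inv_mul_quad {A : Matrix (Fin n) (Fin n) ℝ} (hA : A.PosDef)
    (g v : Vec n) : (inner ℝ g v) ^ 2 ≤ quad A⁻¹ g * quad A v := by
  have hT : Aᵀ = A := by
    rw [← Matrix.conjTranspose_eq_transpose_of_trivial]
    exact hA.isHermitian
  have key : ∀ t : ℝ, 0 ≤ quad A⁻¹ g * (t * t) + (-(2 * inner ℝ g v)) * t + quad A v := by
    intro t
    set w : Vec n := WithLp.toLp 2 (A⁻¹ *ᵥ g.ofLp) with hw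
    have h := quad_nonneg hA (v - t • w)
    have e : quad A (v - t • w) = quad A v - 2 * t * inner ℝ g v + t ^ 2 * quad A⁻¹ g := by
      rw [← quad_inv_mulVec hA g, ← hw]
      have h1 : A *ᵥ w.ofLp = g.ofLp := mulVec_inv_mulVec hA g.ofLp
      have h2 : w.ofLp ⬝ᵥ A *ᵥ v.ofLp = inner ℝ g v := by
        rw [Matrix.dotProduct_mulVec, ← Matrix.mulVec_transpose, hT, h1, dotProduct_ofLp_eq_inner]
      have h3 : v.ofLp ⬝ᵥ g.ofLp = inner ℝ g v := by
        rw [dotProduct_comm, dotProduct_ofLp_eq_inner]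
      simp only [quad, WithLp.ofLp_sub, WithLp.ofLp_smul, Matrix.mulVec_sub, Matrix.mulVec_smul,
        sub_dotProduct, dotProduct_sub, smul_dotProduct, dotProduct_smul, h1, h2, h3, smul_eq_mul]
      ring
    rw [e] at h
    linarith
  have := discrim_le_zero key
  rw [discrim] at this
  linarith

theorem abs_inner_le_sqrt_quad_inv_mul_sqrt_quad {A : Matrix (Fin n) (Fin n) ℝ} (hA : A.PosDef)
    (g v : Vec n) : |inner ℝ g v| ≤ √(quad A⁻¹ g) * √(quad A v) := by
  rw [← Real.sqrt_mul (quad_nonneg hA.inv g)]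
  exact Real.abs_le_sqrt (inner_sq_le_quad_inv_mul_quad hA g v)

theorem posDef_smul_vecMulVec_add {A : Matrix (Fin n) (Fin n) ℝ} (hA : A.PosDef) {t : ℝ}
    (ht : 0 ≤ t) (a : Vec n) : (A + t • Matrix.vecMulVec a.ofLp a.ofLp).PosDef := by
  refine hA.add_posSemidef (Matrix.PosSemidef.smul ?_ ht)
  simpa using Matrix.posSemidef_vecMulVec_self_star a.ofLp

/-- The matrix determinant lemma for a rank one update, as an inequality. -/
theorem mul_det_le_det_add_smul_vecMulVec {A : Matrix (Fin n) (Fin n) ℝ} (hA : A.PosDef)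
    {t c : ℝ} (ht : 0 ≤ t) (a : Vec n) {v : Vec n} (hv : v ≠ 0)
    (h : c * quad A v ≤ t * (inner ℝ a v) ^ 2) :
    (1 + c) * A.det ≤ (A + t • Matrix.vecMulVec a.ofLp a.ofLp).det := by
  have hdet : (A + t • Matrix.vecMulVec a.ofLp a.ofLp).det = A.det * (1 + t * quad A⁻¹ a) := by
    have e : t • Matrix.vecMulVec a.ofLp a.ofLp =
        Matrix.replicateCol Unit (t • a.ofLp) * Matrix.replicateRow Unit a.ofLp := by
      rw [← Matrix.vecMulVec_eq, Matrix.smul_vecMulVec]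
    rw [e, Matrix.det_add_replicateCol_mul_replicateRow (isUnit_iff_ne_zero.2 hA.det_pos.ne')]
    congr 1
    rw [Matrix.det_unique, Matrix.add_apply, Matrix.one_apply_eq, Matrix.mul_assoc,
      ← Matrix.replicateCol_mulVec, Matrix.replicateRow_mul_replicateCol_apply,
      Matrix.mulVec_smul, dotProduct_smul, smul_eq_mul, quad]
  rw [hdet, mul_comm]
  refine mul_le_mul_of_nonneg_left ?_ hA.det_pos.le
  have hq := quad_pos hA hv
  -- By Cauchy–Schwarz a single witness `v` already gives `t aᵀA⁻¹a ≥ c`, which is what the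
  -- determinant formula needs.
  have hcs := mul_le_mul_of_nonneg_left (inner_sq_le_quad_inv_mul_quad hA a v) ht
  have : c * quad A v ≤ (t * quad A⁻¹ a) * quad A v := by linarith
  have := le_of_mul_le_mul_right this hq
  linarith

end Quad

/-! ### Volumes of cubes and ellipsoids -/

section Volume

variable {n : ℕ}

theorem volume_cube (z : Vec n) (t : ℝ) :
    volume {x : Vec n | ∀ i, |x i - z i| ≤ t} = ENNReal.ofReal (2 * t) ^ n := by
  have e : {x : Vec n | ∀ i, |x i - z i| ≤ t} =
      WithLp.ofLp ⁻¹' Set.Icc (fun i => z i - t) (fun i => z i + t) := by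
    ext x
    simp only [Set.mem_ofPred_eq, Set.mem_preimage, Set.mem_Icc, Pi.le_def, ← forall_and]
    refine forall_congr' fun i => ?_
    rw [abs_le]
    constructor <;> rintro ⟨h1, h2⟩ <;> constructor <;> linarith
  rw [e, (PiLp.volume_preserving_ofLp (Fin n)).measure_preimage
    measurableSet_Icc.nullMeasurableSet, Real.volume_Icc_pi]
  have h : ∀ i, z i + t - (z i - t) = 2 * t := fun i => by ring
  simp only [h, Finset.prod_const, Finset.card_univ, Fintype.card_fin]

theorem volume_closedBall_le (z : Vec n) (t : ℝ) :
    volume (Metric.closedBall z t) ≤ ENNReal.ofReal (2 * t) ^ n := by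
  rw [← volume_cube z t]
  refine measure_mono fun x hx i => ?_
  have := PiLp.norm_apply_le (x - z) i
  rw [mem_closedBall_iff_norm] at hx
  simpa using this.trans hx

theorem volume_le_volume_closedBall (z : Vec n) {t : ℝ} (ht : 0 ≤ t) :
    ENNReal.ofReal (2 * t) ^ n ≤ volume (Metric.closedBall z (t * √n)) := by
  rw [← volume_cube z t]
  refine measure_mono fun x hx => ?_
  rw [mem_closedBall_iff_norm, EuclideanSpace.norm_eq]
  refine Real.sqrt_le_iff.2 ⟨by positivity, ?_⟩
  calc ∑ i, ‖(x - z) i‖ ^ 2 ≤ ∑ _i : Fin n, t ^ 2 := by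
        refine Finset.sum_le_sum fun i _ => ?_
        have := hx i
        simp only [PiLp.sub_apply, Real.norm_eq_abs]
        gcongr
    _ = (t * √n) ^ 2 := by
        rw [mul_pow, Real.sq_sqrt (Nat.cast_nonneg n)]
        simp [mul_comm]

open scoped ComplexOrder MatrixOrder in
theorem exists_eq_transpose_mul_self {A : Matrix (Fin n) (Fin n) ℝ} (hA : A.PosDef) :
    ∃ M : Matrix (Fin n) (Fin n) ℝ, A = Mᵀ * M := by
  obtain ⟨M, hM⟩ := CStarAlgebra.nonneg_iff_eq_star_mul_self.mp hA.posSemidef.nonneg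
  exact ⟨M, by simpa [Matrix.star_eq_conjTranspose] using hM⟩

/-- Writing `A = MᵀM`, the map `M` sends the ellipsoid into a ball of radius `t`, hence into a cube
of side `2t`, and scales volume by `√(det A)`. -/
theorem volume_ellipsoid_le {A : Matrix (Fin n) (Fin n) ℝ} (hA : A.PosDef) (z : Vec n) {t : ℝ}
    (ht : 0 ≤ t) :
    volume (ellipsoid A z t) ≤ ENNReal.ofReal ((2 * t) ^ n / √A.det) := by
  obtain ⟨M, hM⟩ := exists_eq_transpose_mul_self hA
  set f : Vec n →ₗ[ℝ] Vec n := Matrix.toLpLin 2 2 M with hf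
  have hdet : LinearMap.det f = M.det := LinearMap.det_toLpLin 2 M
  have habs : √A.det = |M.det| := by
    rw [hM, Matrix.det_mul, Matrix.det_transpose, Real.sqrt_mul_self_eq_abs]
  have hpos : 0 < |M.det| := habs ▸ Real.sqrt_pos.2 hA.det_pos
  have hq : ∀ v : Vec n, quad A v = ‖f v‖ ^ 2 := by
    intro v
    rw [← real_inner_self_eq_norm_sq, ← dotProduct_ofLp_eq_inner, quad, hM,
      ← Matrix.mulVec_mulVec, Matrix.dotProduct_mulVec, ← Matrix.mulVec_transpose,
      Matrix.transpose_transpose]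
    rfl
  have himg : f '' ellipsoid A z t ⊆ Metric.closedBall (f z) t := by
    rintro _ ⟨x, hx, rfl⟩
    rw [mem_closedBall_iff_norm, ← map_sub]
    have h : quad A (x - z) ≤ t ^ 2 := hx
    rw [hq] at h
    exact (pow_le_pow_iff_left₀ (norm_nonneg _) ht two_ne_zero).1 h
  have h := (measure_mono himg).trans (volume_closedBall_le (f z) t)
  rw [Measure.addHaar_image_linearMap, hdet] at h
  rw [habs, ENNReal.ofReal_div_of_pos hpos, ENNReal.le_div_iff_mul_le
    (Or.inl (by simpa using hpos)) (Or.inl ENNReal.ofReal_ne_top),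
    ENNReal.ofReal_pow (by positivity), mul_comm]
  exact h

end Volume

/-! ### The barrier function -/

/-- After cubing, the claim is `(1 - 3t)(1 - t)³ ≤ (1 - 2t)³`, and the difference of the two sides
is `t³(2 - 3t)`. This is the only link needed between the decrement and `q`. -/
theorem le_qFun_mul_one_sub {t : ℝ} (h0 : 0 ≤ t) (h1 : t < 1 / 3) : t ≤ qFun t * (1 - t) := by
  have ht : 0 < 1 - t := by linarith
  have hy : (1 - 3 * t) ^ (1 / 3 : ℝ) ≤ (1 - 2 * t) / (1 - t) := by
    have hy0 : 0 ≤ (1 - 2 * t) / (1 - t) := div_nonneg (by linarith) ht.le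
    have h : 1 - 3 * t ≤ ((1 - 2 * t) / (1 - t)) ^ 3 := by
      rw [div_pow, le_div_iff₀ (by positivity)]
      have : 0 ≤ t ^ 3 * (2 - 3 * t) := mul_nonneg (by positivity) (by linarith)
      nlinarith
    calc (1 - 3 * t) ^ (1 / 3 : ℝ) ≤ (((1 - 2 * t) / (1 - t)) ^ 3) ^ (1 / 3 : ℝ) :=
          Real.rpow_le_rpow (by linarith) h (by norm_num)
      _ = (1 - 2 * t) / (1 - t) := by
          have := Real.pow_rpow_inv_natCast hy0 (n := 3) (by norm_num)
          simpa using this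
  rw [le_div_iff₀ ht] at hy
  rw [qFun]
  linarith

theorem qFun_nonneg {t : ℝ} (h0 : 0 ≤ t) (h1 : t < 1 / 3) : 0 ≤ qFun t := by
  have h := le_qFun_mul_one_sub h0 h1
  exact nonneg_of_mul_nonneg_left (h0.trans h) (by linarith)

theorem le_qFun {t : ℝ} (h0 : 0 ≤ t) (h1 : t < 1 / 3) : t ≤ qFun t := by
  have h := le_qFun_mul_one_sub h0 h1
  nlinarith [mul_nonneg (qFun_nonneg h0 h1) h0]

theorem Constants.ρ₀_lt_one_div (C : Constants) : C.ρ₀ < 1 / 16 :=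
  (le_qFun C.ρ₀_pos.le C.ρ₀_lt).trans_lt C.ζ₀_lt

namespace Cuts

variable {n : ℕ} (S : Cuts n)

theorem quad_hess (x v : Vec n) :
    quad (S.hess x) v = ∑ i ∈ S.idx, (inner ℝ (S.a i) v / S.slack i x) ^ 2
      + 4 / (1 - ‖x‖ ^ 2) ^ 2 * (inner ℝ x v) ^ 2 + 2 / (1 - ‖x‖ ^ 2) * ‖v‖ ^ 2 := by
  rw [hess, quad_add_left, quad_add_left, quad_sum, quad_smul_left, quad_smul_left, quad_one,
    quad_vecMulVec]
  congr 2
  refine Finset.sum_congr rfl fun i _ => ?_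
  rw [quad_smul_left, quad_vecMulVec, div_pow, div_eq_inv_mul]

theorem inner_grad (x v : Vec n) :
    inner ℝ (S.grad x) v = -∑ i ∈ S.idx, inner ℝ (S.a i) v / S.slack i x
      + 2 / (1 - ‖x‖ ^ 2) * inner ℝ x v := by
  rw [grad, inner_add_left, inner_neg_left, sum_inner, real_inner_smul_left]
  congr 2
  refine Finset.sum_congr rfl fun i _ => ?_
  rw [real_inner_smul_left, div_eq_inv_mul]

theorem posDef_hess {x : Vec n} (hx : x ∈ S.domain) : (S.hess x).PosDef := by
  have h0 := S.one_sub_norm_sq_pos hx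
  have hv : ∀ a : Vec n, (Matrix.vecMulVec a.ofLp a.ofLp).PosSemidef := fun a => by
    simpa using Matrix.posSemidef_vecMulVec_self_star a.ofLp
  rw [hess]
  refine Matrix.PosDef.posSemidef_add (Matrix.PosSemidef.add
    (Matrix.posSemidef_sum _ fun i _ => (hv _).smul (by positivity))
    ((hv _).smul (by positivity))) (Matrix.PosDef.one.smul (by positivity))

theorem abs_inner_grad_le {x : Vec n} (hx : x ∈ S.domain) (v : Vec n) :
    |inner ℝ (S.grad x) v| ≤ S.newtonDecrement x * √(quad (S.hess x) v) :=
  abs_inner_le_sqrt_quad_inv_mul_sqrt_quad (S.posDef_hess hx) _ _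

theorem newtonDecrement_nonneg (x : Vec n) : 0 ≤ S.newtonDecrement x := Real.sqrt_nonneg _

theorem slack_add (i : ℕ) (x d : Vec n) : S.slack i (x + d) = S.slack i x + inner ℝ (S.a i) d := by
  rw [slack, slack, inner_add_right]
  ring

/-- The factorization `1 - ‖z + t d‖² = (1 - ‖z‖²) (1 + t ξ) (1 + t η)`. -/
theorem exists_ball_factors {A C : ℝ} (B : ℝ) (hA : 0 < A) (hC : 0 ≤ C) :
    ∃ ξ η : ℝ, ξ ≤ 0 ∧ 0 ≤ η ∧ ξ * η = -(C / A) ∧ ξ + η = -(2 * B / A) := by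
  set D := √((B / A) ^ 2 + C / A) with hD
  have hCA : 0 ≤ C / A := by positivity
  have hD2 : D ^ 2 = (B / A) ^ 2 + C / A := Real.sq_sqrt (by positivity)
  have hDB : |B / A| ≤ D := Real.abs_le_sqrt (by linarith)
  obtain ⟨h1, h2⟩ := abs_le.1 hDB
  exact ⟨-(B / A) - D, -(B / A) + D, by linarith, by linarith, by linear_combination -hD2, by ring⟩

/-- The relative changes of the factors under the logarithms of the barrier, when the argument moves
from `z` to `z + d`; the ball contributes the two roots of a quadratic polynomial. -/
theorem exists_relative_changes {z : Vec n} (hz : z ∈ S.domain) (d : Vec n) :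
    ∃ ξ : Option (Option S.idx) → ℝ,
      inner ℝ (S.grad z) d = -∑ k, ξ k ∧
      quad (S.hess z) d = ∑ k, ξ k ^ 2 ∧
      (z + d ∈ S.region → ∀ k, -1 ≤ ξ k) ∧
      (z + d ∈ S.domain → (∀ k, -1 < ξ k) ∧
        inner ℝ (S.grad (z + d)) d = -∑ k, ξ k / (1 + ξ k) ∧
        quad (S.hess (z + d)) d = ∑ k, (ξ k / (1 + ξ k)) ^ 2) := by
  have hA := S.one_sub_norm_sq_pos hz
  obtain ⟨ξ, η, hξ, hη, hmul, hadd⟩ :=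
    exists_ball_factors (inner ℝ z d) hA (sq_nonneg ‖d‖)
  have hnorm : ‖z + d‖ ^ 2 = ‖z‖ ^ 2 + 2 * inner ℝ z d + ‖d‖ ^ 2 := norm_add_sq_real z d
  set A := 1 - ‖z‖ ^ 2 with hAdef
  set B : ℝ := inner ℝ z d with hB
  have hmul' : A * (ξ * η) = -‖d‖ ^ 2 := by rw [hmul]; field_simp
  have hadd' : A * (ξ + η) = -(2 * B) := by rw [hadd]; field_simp
  have hfac : 1 - ‖z + d‖ ^ 2 = A * ((1 + ξ) * (1 + η)) := by
    rw [hnorm]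
    linear_combination -hmul' - hadd' - hAdef
  refine ⟨fun k => k.elim ξ fun k => k.elim η fun i => inner ℝ (S.a i) d / S.slack i z,
    ?_, ?_, ?_, ?_⟩
  · simp only [Fintype.sum_option, Option.elim]
    rw [inner_grad, Finset.sum_coe_sort S.idx fun i => inner ℝ (S.a i) d / S.slack i z, ← hAdef,
      ← hB]
    have : 2 / A * B = 2 * B / A := by ring
    linarith
  · simp only [Fintype.sum_option, Option.elim]
    rw [quad_hess, Finset.sum_coe_sort S.idx fun i => (inner ℝ (S.a i) d / S.slack i z) ^ 2, ← hAdef,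
      ← hB]
    have : ξ ^ 2 + η ^ 2 = 4 / A ^ 2 * B ^ 2 + 2 / A * ‖d‖ ^ 2 := by
      have e : 4 / A ^ 2 = (2 / A) ^ 2 := by rw [div_pow]; norm_num
      rw [e]
      linear_combination (ξ + η - 2 * B / A) * hadd - 2 * hmul
    linarith
  · intro hr
    have hslack : ∀ i ∈ S.idx, -1 ≤ inner ℝ (S.a i) d / S.slack i z := fun i hi => by
      have h := hr.2 i hi
      rw [le_div_iff₀ (S.slack_pos hz hi), slack]
      rw [inner_add_right] at h
      linarith
    have hball : 0 ≤ A * ((1 + ξ) * (1 + η)) := by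
      have h1 := hr.1
      have h0 := norm_nonneg (z + d)
      rw [← hfac]
      nlinarith
    rintro (_ | _ | i)
    -- Since `ξ ≤ 0 ≤ η`, the factor `1 + η` is positive, so the ball constraint bears on `ξ` alone.
    · have h := nonneg_of_mul_nonneg_right hball hA
      have := nonneg_of_mul_nonneg_left h (by linarith)
      change -1 ≤ ξ
      linarith
    · change -1 ≤ η
      linarith
    · exact hslack i i.2
  · intro hr
    have hA' := S.one_sub_norm_sq_pos hr
    have hslack : ∀ i ∈ S.idx, -1 < inner ℝ (S.a i) d / S.slack i z := fun i hi => by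
      have h := S.slack_pos hr hi
      rw [slack_add] at h
      rw [lt_div_iff₀ (S.slack_pos hz hi)]
      linarith
    have hξ1 : 0 < 1 + ξ := by
      have h : 0 < (1 + ξ) * (1 + η) := pos_of_mul_pos_right (hfac ▸ hA') hA.le
      exact pos_of_mul_pos_left h (by linarith)
    have hη1 : 0 < 1 + η := by linarith
    have hdiv : ∀ i ∈ S.idx, inner ℝ (S.a i) d / S.slack i (z + d) =
        inner ℝ (S.a i) d / S.slack i z / (1 + inner ℝ (S.a i) d / S.slack i z) := fun i hi => by
      have h0 := (S.slack_pos hz hi).ne'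
      have h1 := (S.slack_pos hr hi).ne'
      rw [slack_add] at h1 ⊢
      field_simp
    have hsum : ξ / (1 + ξ) + η / (1 + η) = -(2 / (1 - ‖z + d‖ ^ 2) * (B + ‖d‖ ^ 2)) := by
      rw [hfac]
      field_simp
      linear_combination hadd' + 2 * hmul'
    have hprod : ξ / (1 + ξ) * (η / (1 + η)) = -(‖d‖ ^ 2 / (1 - ‖z + d‖ ^ 2)) := by
      rw [hfac]
      field_simp
      linear_combination hmul'
    have hin : inner ℝ (z + d) d = B + ‖d‖ ^ 2 := by
      rw [inner_add_left, real_inner_self_eq_norm_sq]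
    refine ⟨?_, ?_, ?_⟩
    · rintro (_ | _ | i)
      · change -1 < ξ
        linarith
      · change -1 < η
        linarith
      · exact hslack i i.2
    · simp only [Fintype.sum_option, Option.elim]
      rw [inner_grad, Finset.sum_coe_sort S.idx fun i => inner ℝ (S.a i) d / S.slack i z /
        (1 + inner ℝ (S.a i) d / S.slack i z), hin, Finset.sum_congr rfl hdiv]
      linarith
    · simp only [Fintype.sum_option, Option.elim]
      rw [quad_hess, Finset.sum_coe_sort S.idx fun i => (inner ℝ (S.a i) d / S.slack i z /
        (1 + inner ℝ (S.a i) d / S.slack i z)) ^ 2, hin,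
        Finset.sum_congr rfl fun i hi => by rw [hdiv i hi]]
      have : (ξ / (1 + ξ)) ^ 2 + (η / (1 + η)) ^ 2 =
          4 / (1 - ‖z + d‖ ^ 2) ^ 2 * (B + ‖d‖ ^ 2) ^ 2 + 2 / (1 - ‖z + d‖ ^ 2) * ‖d‖ ^ 2 := by
        have e : 4 / (1 - ‖z + d‖ ^ 2) ^ 2 = (2 / (1 - ‖z + d‖ ^ 2)) ^ 2 := by
          rw [div_pow]; norm_num
        rw [e]
        linear_combination (ξ / (1 + ξ) + η / (1 + η)
          - 2 / (1 - ‖z + d‖ ^ 2) * (B + ‖d‖ ^ 2)) * hsum - 2 * hprod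
      linarith

end Cuts

/-! ### Bounds on relative changes when the gradients are small -/

/-- The numbers `1 + ξ k` are nonnegative, so the sum of their squares is at most the square of
their sum `Y`. The small gradient keeps `Y` close to the number of factors, `h + 2`. -/
theorem sum_sq_le_of_neg_one_le {ι : Type*} [Fintype ι] {ξ : ι → ℝ} {ρ h : ℝ}
    (hρ : ρ ≤ 1 / 16) (hh : 1 ≤ h) (hcard : (Fintype.card ι : ℝ) = h + 2) (hξ : ∀ k, -1 ≤ ξ k)
    (hsum : |∑ k, ξ k| ≤ ρ * √(∑ k, ξ k ^ 2)) : ∑ k, ξ k ^ 2 ≤ (6 * h) ^ 2 := by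
  set r := √(∑ k, ξ k ^ 2) with hr
  have hr0 : 0 ≤ r := Real.sqrt_nonneg _
  have hr2 : ∑ k, ξ k ^ 2 = r ^ 2 := (Real.sq_sqrt (Finset.sum_nonneg fun k _ => sq_nonneg _)).symm
  set Y := ∑ k, (1 + ξ k) with hY
  have hY0 : 0 ≤ Y := Finset.sum_nonneg fun k _ => by linarith [hξ k]
  have hYs : Y = h + 2 + ∑ k, ξ k := by
    rw [hY, Finset.sum_add_distrib, ← hcard]
    simp
  have hsq : ∑ k, (1 + ξ k) ^ 2 ≤ Y ^ 2 :=
    Finset.sum_sq_le_sq_sum_of_nonneg fun k _ => by linarith [hξ k]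
  have hexp : ∑ k, (1 + ξ k) ^ 2 = r ^ 2 + 2 * Y - (h + 2) := by
    rw [← hr2, ← hcard, hY, Finset.mul_sum, eq_sub_iff_add_eq, ← Finset.sum_add_distrib]
    have : (Fintype.card ι : ℝ) = ∑ _k : ι, (1 : ℝ) := by simp
    rw [this, ← Finset.sum_add_distrib]
    exact Finset.sum_congr rfl fun k _ => by ring
  have hYle : Y ≤ h + 2 + r / 16 := by
    have := (abs_le.1 hsum).2
    nlinarith
  rw [hr2]
  refine pow_le_pow_left₀ hr0 ?_ 2
  by_contra! hlt
  -- Expanding the squares gives `r² ≤ (Y - 1)² + h + 1`. If `r > 6h`, then `h + 1 ≤ 2h < r/3`, and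
  -- the right side is too small.
  have h1 : (Y - 1) ^ 2 ≤ (h + 1 + r / 16) ^ 2 := sq_le_sq' (by linarith) (by linarith)
  have h2 : (h + 1 + r / 16) ^ 2 ≤ (r / 3 + r / 16) ^ 2 := by
    refine pow_le_pow_left₀ (by positivity) ?_ 2
    linarith
  nlinarith

/-- The change of gradient `G` equals `∑ ξ²/(1 + ξ)`; it dominates both `r - 1` and `r' - 1`, the
lengths of the step measured at its two ends. The hypothesis then reads `G ≤ (2/3)G + 2` at worst,
so `G ≤ 6` and `r ≤ 7`. -/
theorem sqrt_sum_sq_le_seven {ι : Type*} [Fintype ι] {ξ : ι → ℝ} {ρ : ℝ}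
    (hρ : ρ ≤ 1 / 3) (hξ : ∀ k, -1 < ξ k)
    (hG : ∑ k, ξ k - ∑ k, ξ k / (1 + ξ k) ≤
      ρ * √(∑ k, ξ k ^ 2) + ρ * (√(∑ k, (ξ k / (1 + ξ k)) ^ 2) + 1) + 1) :
    √(∑ k, ξ k ^ 2) ≤ 7 := by
  set r := √(∑ k, ξ k ^ 2) with hr
  set r' := √(∑ k, (ξ k / (1 + ξ k)) ^ 2) with hr'
  have hr0 : 0 ≤ r := Real.sqrt_nonneg _
  have hr0' : 0 ≤ r' := Real.sqrt_nonneg _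
  have hr2 : ∑ k, ξ k ^ 2 = r ^ 2 := (Real.sq_sqrt (Finset.sum_nonneg fun k _ => sq_nonneg _)).symm
  have hr2' : ∑ k, (ξ k / (1 + ξ k)) ^ 2 = r' ^ 2 :=
    (Real.sq_sqrt (Finset.sum_nonneg fun k _ => sq_nonneg _)).symm
  have hle : ∀ k, |ξ k| ≤ r := fun k => Real.abs_le_sqrt
    (Finset.single_le_sum (f := fun k => ξ k ^ 2) (fun k _ => sq_nonneg _) (Finset.mem_univ k))
  have hle' : ∀ k, |ξ k / (1 + ξ k)| ≤ r' := fun k => Real.abs_le_sqrt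
    (Finset.single_le_sum (f := fun k => (ξ k / (1 + ξ k)) ^ 2) (fun k _ => sq_nonneg _)
      (Finset.mem_univ k))
  set G := ∑ k, ξ k - ∑ k, ξ k / (1 + ξ k) with hGdef
  have h1 : r ^ 2 ≤ G * (1 + r) := by
    rw [← hr2, hGdef, ← Finset.sum_sub_distrib, Finset.sum_mul]
    refine Finset.sum_le_sum fun k _ => ?_
    have hk : 0 < 1 + ξ k := by linarith [hξ k]
    have e : ξ k - ξ k / (1 + ξ k) = ξ k ^ 2 / (1 + ξ k) := by field_simp; ring
    rw [e, div_mul_eq_mul_div, le_div_iff₀ hk]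
    exact mul_le_mul_of_nonneg_left (by linarith [(abs_le.1 (hle k)).2]) (sq_nonneg _)
  have h2 : r' ^ 2 ≤ G * (1 + r') := by
    rw [← hr2', hGdef, ← Finset.sum_sub_distrib, Finset.sum_mul]
    refine Finset.sum_le_sum fun k _ => ?_
    have hk : 0 < 1 + ξ k := by linarith [hξ k]
    have e : ξ k - ξ k / (1 + ξ k) = (ξ k / (1 + ξ k)) ^ 2 * (1 + ξ k) := by field_simp; ring
    have h3 : 1 = (1 + ξ k) * (1 - ξ k / (1 + ξ k)) := by field_simp; ring
    have h4 : 1 - ξ k / (1 + ξ k) ≤ 1 + r' := by linarith [(abs_le.1 (hle' k)).1]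
    rw [e, mul_assoc]
    refine le_mul_of_one_le_right (sq_nonneg _) ?_
    calc (1 : ℝ) = (1 + ξ k) * (1 - ξ k / (1 + ξ k)) := h3
      _ ≤ _ := mul_le_mul_of_nonneg_left h4 hk.le
  have h1' : r - 1 ≤ G := by
    by_contra! h
    nlinarith
  have h2' : r' - 1 ≤ G := by
    by_contra! h
    nlinarith
  nlinarith

/-! ### Geometry of approximate centres -/

namespace Cuts

variable {n : ℕ} (S : Cuts n)

theorem region_subset_ellipsoid {z : Vec n} (hz : z ∈ S.domain)
    (hl : S.newtonDecrement z ≤ 1 / 16) (hh : 1 ≤ S.h) :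
    S.region ⊆ ellipsoid (S.hess z) z (6 * S.h) := by
  intro x hx
  obtain ⟨ξ, hg, hq, hξ, -⟩ := S.exists_relative_changes hz (x - z)
  rw [add_sub_cancel] at hξ
  change quad (S.hess z) (x - z) ≤ _
  rw [hq]
  refine sum_sq_le_of_neg_one_le hl (by exact_mod_cast hh) ?_ (hξ hx) ?_
  · simp [h]
    ring
  · have := S.abs_inner_grad_le hz (x - z)
    rwa [hg, hq, abs_neg] at this

/-- If `z` points away from `c`, the cuts and the ball both push the gradient along `c` in the same
direction, so they cannot cancel. The Hessian along `c` exceeds the square of this derivative by at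
most `T = 2/(1 - ‖z‖²)`, and Cauchy–Schwarz with decrement `l` leaves little room for `m`. -/
theorem neg_inner_mul_sqrt_two_le {z c : Vec n} (hz : z ∈ S.domain)
    (hl : S.newtonDecrement z < 1 / 3) (hc : ‖c‖ = 1) (ha : ∀ i ∈ S.idx, 0 ≤ inner ℝ (S.a i) c) :
    -inner ℝ z c * √2 ≤ qFun (S.newtonDecrement z) := by
  set l := S.newtonDecrement z with hl'
  have hl0 : 0 ≤ l := S.newtonDecrement_nonneg z
  have hq0 := qFun_nonneg hl0 hl
  have hq := le_qFun_mul_one_sub hl0 hl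
  set m : ℝ := -inner ℝ z c with hm
  rcases le_or_gt m 0 with hm0 | hm0
  · exact (mul_nonpos_of_nonpos_of_nonneg hm0 (Real.sqrt_nonneg _)).trans hq0
  have hA := S.one_sub_norm_sq_pos hz
  set T := 2 / (1 - ‖z‖ ^ 2) with hT
  have hT2 : 2 ≤ T := by
    rw [hT, le_div_iff₀ hA]
    nlinarith [sq_nonneg ‖z‖]
  set Y := ∑ i ∈ S.idx, inner ℝ (S.a i) c / S.slack i z with hY
  have hY0 : ∀ i ∈ S.idx, 0 ≤ inner ℝ (S.a i) c / S.slack i z := fun i hi =>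
    div_nonneg (ha i hi) (S.slack_pos hz hi).le
  have hYs : 0 ≤ Y := Finset.sum_nonneg hY0
  have hY2 : ∑ i ∈ S.idx, (inner ℝ (S.a i) c / S.slack i z) ^ 2 ≤ Y ^ 2 :=
    Finset.sum_sq_le_sq_sum_of_nonneg hY0
  have hg : inner ℝ (S.grad z) c = -(Y + T * m) := by
    rw [inner_grad]
    ring
  have hH : quad (S.hess z) c ≤ (Y + T * m) ^ 2 + T := by
    have e : 4 / (1 - ‖z‖ ^ 2) ^ 2 = T ^ 2 := by rw [hT, div_pow]; norm_num
    rw [quad_hess, hc, e]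
    nlinarith [mul_nonneg hYs (mul_nonneg (by linarith : 0 ≤ T) hm0.le)]
  have hcs := inner_sq_le_quad_inv_mul_quad (S.posDef_hess hz) (S.grad z) c
  have hl2 : quad (S.hess z)⁻¹ (S.grad z) = l ^ 2 :=
    (Real.sq_sqrt (quad_nonneg (S.posDef_hess hz).inv _)).symm
  rw [hg, hl2, neg_sq] at hcs
  have h1 : (Y + T * m) ^ 2 ≤ l ^ 2 * ((Y + T * m) ^ 2 + T) :=
    hcs.trans (mul_le_mul_of_nonneg_left hH (sq_nonneg l))
  have hTm : (T * m) ^ 2 ≤ (Y + T * m) ^ 2 := by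
    refine pow_le_pow_left₀ (by positivity) (by linarith) 2
  have hl1 : 0 < 1 - l ^ 2 := by nlinarith
  have h2 : (1 - l ^ 2) * (T * m ^ 2) ≤ l ^ 2 := by
    have : T * ((1 - l ^ 2) * (T * m ^ 2)) ≤ T * l ^ 2 := by
      nlinarith [mul_le_mul_of_nonneg_left hTm hl1.le]
    exact le_of_mul_le_mul_left this (by linarith)
  have h3 : (1 - l ^ 2) * (2 * m ^ 2) ≤ l ^ 2 := by
    refine le_trans ?_ h2
    refine mul_le_mul_of_nonneg_left ?_ hl1.le
    exact mul_le_mul_of_nonneg_right hT2 (sq_nonneg m)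
  have h4 : l ^ 2 ≤ (1 - l ^ 2) * qFun l ^ 2 := by
    calc l ^ 2 ≤ (qFun l * (1 - l)) ^ 2 := pow_le_pow_left₀ hl0 hq 2
      _ = (1 - l) ^ 2 * qFun l ^ 2 := by ring
      _ ≤ _ := mul_le_mul_of_nonneg_right (by nlinarith) (sq_nonneg _)
  have h5 : 2 * m ^ 2 ≤ qFun l ^ 2 := le_of_mul_le_mul_left (h3.trans h4) hl1
  refine (pow_le_pow_iff_left₀ (by positivity) hq0 two_ne_zero).1 ?_
  rw [mul_pow, Real.sq_sqrt (by norm_num)]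
  linarith

variable {S}

theorem sum_add_idx {M : Type*} [AddCommMonoid M] {j : ℕ} (hj : j ∉ S.idx) (v : Vec n) (β : ℝ)
    (f : Vec n → ℝ → M) :
    ∑ i ∈ (S.add j v β).idx, f ((S.add j v β).a i) ((S.add j v β).b i) =
      f v β + ∑ i ∈ S.idx, f (S.a i) (S.b i) := by
  simp only [add]
  rw [Finset.sum_insert hj]
  simp only [Function.update_self]
  congr 1
  refine Finset.sum_congr rfl fun i hi => ?_
  have : i ≠ j := fun h => hj (h ▸ hi)
  simp [Function.update_of_ne this]

theorem region_add_subset {j : ℕ} (hj : j ∉ S.idx) (v : Vec n) (β : ℝ) :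
    (S.add j v β).region ⊆ S.region := by
  refine fun x hx => ⟨hx.1, fun i hi => ?_⟩
  have h := hx.2 i (Finset.mem_insert_of_mem hi)
  have hij : i ≠ j := fun h => hj (h ▸ hi)
  simpa [add, Function.update_of_ne hij] using h

theorem domain_add_subset {j : ℕ} (hj : j ∉ S.idx) (v : Vec n) (β : ℝ) :
    (S.add j v β).domain ⊆ S.domain := by
  refine fun x hx => ⟨hx.1, fun i hi => ?_⟩
  have h := hx.2 i (Finset.mem_insert_of_mem hi)
  have hij : i ≠ j := fun h => hj (h ▸ hi)
  simpa [add, Function.update_of_ne hij] using h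

/-- Recentring after a shallow cut increases the slack of the new cut by a bounded factor only. -/
theorem slack_le_of_add {z z' v : Vec n} {β γ : ℝ} {j : ℕ} (hj : j ∉ S.idx) (hz : z ∈ S.domain)
    (hz' : z' ∈ (S.add j v β).domain) (hl : S.newtonDecrement z ≤ 1 / 3)
    (hl' : (S.add j v β).newtonDecrement z' ≤ 1 / 3) (hs : 0 < inner ℝ v z - β) (hγ0 : 0 ≤ γ)
    (hγ : quad (S.hess z)⁻¹ v / (inner ℝ v z - β) ^ 2 = γ ^ 2) :
    inner ℝ v z' - β ≤ (1 + 7 * γ) * (inner ℝ v z - β) := by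
  set s := inner ℝ v z - β with hsdef
  set s' := inner ℝ v z' - β with hsdef'
  rcases le_or_gt s' s with hle | hlt
  · nlinarith [mul_nonneg hγ0 hs.le]
  have hs' : 0 < s' := hs.trans hlt
  set d := z' - z with hd
  have hzd : z + d = z' := add_sub_cancel z z'
  have hvd : inner ℝ v d = s' - s := by
    rw [hd, inner_sub_right]
    ring
  have hdom := domain_add_subset hj v β hz'
  obtain ⟨ξ, hg, hq, -, h⟩ := S.exists_relative_changes hz d
  rw [hzd] at h
  obtain ⟨hξ, hg', hq'⟩ := h hdom
  have hfr0 : 0 ≤ (s' - s) / s' := div_nonneg (by linarith) hs'.le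
  have hfr1 : (s' - s) / s' ≤ 1 := by
    rw [div_le_one hs']
    linarith
  have hgadd : inner ℝ ((S.add j v β).grad z') d = inner ℝ (S.grad z') d - (s' - s) / s' := by
    rw [inner_grad, inner_grad]
    simp only [slack]
    rw [sum_add_idx hj v β fun a b => inner ℝ a d / (inner ℝ a z' - b), hvd, ← hsdef']
    ring
  have hqadd : quad ((S.add j v β).hess z') d = quad (S.hess z') d + ((s' - s) / s') ^ 2 := by
    rw [quad_hess, quad_hess]
    simp only [slack]
    rw [sum_add_idx hj v β fun a b => (inner ℝ a d / (inner ℝ a z' - b)) ^ 2, hvd, ← hsdef']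
    ring
  have hb1 : ∑ k, ξ k ≤ 1 / 3 * √(∑ k, ξ k ^ 2) := by
    have h1 := (abs_le.1 (S.abs_inner_grad_le hz d)).1
    rw [hg, hq] at h1
    have := mul_le_mul_of_nonneg_right hl (Real.sqrt_nonneg (∑ k, ξ k ^ 2))
    linarith
  have hb2 : inner ℝ ((S.add j v β).grad z') d ≤
      1 / 3 * (√(∑ k, (ξ k / (1 + ξ k)) ^ 2) + 1) := by
    refine (le_abs_self _).trans (((S.add j v β).abs_inner_grad_le hz' d).trans ?_)
    refine mul_le_mul hl' ?_ (Real.sqrt_nonneg _) (by norm_num)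
    rw [hqadd, hq']
    refine Real.sqrt_le_iff.2 ⟨by positivity, ?_⟩
    have h0 : 0 ≤ ∑ k, (ξ k / (1 + ξ k)) ^ 2 := Finset.sum_nonneg fun k _ => sq_nonneg _
    nlinarith [Real.sq_sqrt h0, Real.sqrt_nonneg (∑ k, (ξ k / (1 + ξ k)) ^ 2)]
  rw [hgadd, hg'] at hb2
  -- The new cut adds at most `1` to the gradient along `d` and to the local length of `d`, which
  -- accounts for the two extra terms `1` in the hypothesis.
  have h7 := sqrt_sum_sq_le_seven le_rfl hξ (by linarith)
  rw [← hq] at h7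
  have hcs := (le_abs_self _).trans (abs_inner_le_sqrt_quad_inv_mul_sqrt_quad (S.posDef_hess hz) v d)
  have hv : √(quad (S.hess z)⁻¹ v) = γ * s := by
    rw [div_eq_iff (by positivity)] at hγ
    rw [hγ, ← mul_pow, Real.sqrt_sq (by positivity)]
  rw [hvd, hv] at hcs
  nlinarith [mul_le_mul_of_nonneg_left h7 (mul_nonneg hγ0 hs.le)]

end Cuts

/-! ### The cone of robust separating directions -/

section Cone

variable {n : ℕ} {K : Set (Vec n)} {p : Vec n} {R δ : ℝ}

theorem exists_separator (hδ : 0 < δ) (hK : Convex ℝ K) (hne : K.Nonempty) (hp : p ∉ nbhd K δ) :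
    ∃ c : Vec n, ‖c‖ = 1 ∧ ∀ k ∈ K, δ ≤ inner ℝ c (p - k) := by
  obtain ⟨v, hv, hmin⟩ := exists_norm_eq_iInf_of_complete_convex hne.closure
    isClosed_closure.isComplete hK.closure p
  rw [norm_eq_iInf_iff_real_inner_le_zero hK.closure hv] at hmin
  have hdist : δ ≤ ‖p - v‖ := by
    by_contra! hlt
    -- The nearest point `v` is only in the closure, so it is replaced by a point of `K` within the
    -- remaining distance.
    obtain ⟨k, hk, hkv⟩ := Metric.mem_closure_iff.1 hv (δ - ‖p - v‖) (by linarith)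
    refine hp (Set.mem_iUnion₂.2 ⟨k, hk, ?_⟩)
    rw [Metric.mem_closedBall]
    have := dist_triangle p v k
    rw [dist_eq_norm p v] at this
    linarith
  have hpos : 0 < ‖p - v‖ := hδ.trans_le hdist
  refine ⟨‖p - v‖⁻¹ • (p - v), ?_, fun k hk => hdist.trans ?_⟩
  · rw [norm_smul, norm_inv, norm_norm, inv_mul_cancel₀ hpos.ne']
  · have h := hmin k (subset_closure hk)
    have e : inner ℝ (p - v) (p - k) = ‖p - v‖ ^ 2 - inner ℝ (p - v) (k - v) := by
      rw [← real_inner_self_eq_norm_sq, ← inner_sub_right]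
      congr 1
      abel
    rw [real_inner_smul_left, e, inv_mul_eq_div, le_div_iff₀ hpos]
    nlinarith

/-- At the centre, `yᵀ(p - k) ≥ 4δ/5` while only `(3δ/5)‖y‖ = 12δ/25` is needed (`2δ/5` for `δ'` and
`δ/5` for `ε`). The spare `8δ/25` absorbs the perturbation, at most `2Rρ ≤ 2δ/7`, and a second-order
term. -/
theorem closedBall_subset_robustSepCone {c : Vec n} {ρ : ℝ} (hδ : 0 < δ) (hδR : δ < R)
    (hKR : K ⊆ Metric.closedBall 0 R) (hpR : ‖p‖ ≤ R) (hc : ‖c‖ = 1)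
    (hsep : ∀ k ∈ K, δ ≤ inner ℝ c (p - k)) (hρ0 : 0 ≤ ρ) (hρ : 7 * (ρ * R) ≤ δ) :
    Metric.closedBall ((4 / 5 : ℝ) • c) ρ ⊆ robustSepCone K p δ := by
  have hR : 0 < R := hδ.trans hδR
  have hρ7 : ρ ≤ 1 / 7 := by
    by_contra! h
    nlinarith
  intro y hy
  obtain ⟨w, rfl⟩ : ∃ w, y = (4 / 5 : ℝ) • c + w := ⟨y - (4 / 5 : ℝ) • c, by abel⟩
  have hw : ‖w‖ ≤ ρ := by simpa [mem_closedBall_iff_norm] using hy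
  set y := (4 / 5 : ℝ) • c + w with hydef
  have hc45 : ‖(4 / 5 : ℝ) • c‖ = 4 / 5 := by rw [norm_smul, hc]; norm_num
  have hy1 : ‖y‖ ≤ 1 := by
    have := norm_add_le ((4 / 5 : ℝ) • c) w
    linarith
  have hy0 : 0 < ‖y‖ := by
    have := norm_sub_le y w
    rw [hydef, add_sub_cancel_right, hc45, ← hydef] at this
    linarith
  have hcw : |inner ℝ c w| ≤ ‖w‖ := by simpa [hc] using abs_real_inner_le_norm c w
  -- Second-order upper bound for the norm near a vector of length `4/5`; `5/8 = 1/(2 · 4/5)`.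
  have hynorm : ‖y‖ ≤ 4 / 5 + inner ℝ c w + 5 / 8 * ‖w‖ ^ 2 := by
    have h0 : 0 ≤ 4 / 5 + inner ℝ c w + 5 / 8 * ‖w‖ ^ 2 := by
      have := (abs_le.1 hcw).1
      nlinarith [sq_nonneg ‖w‖]
    refine (pow_le_pow_iff_left₀ hy0.le h0 two_ne_zero).1 ?_
    rw [hydef, norm_add_sq_real, hc45, real_inner_smul_left]
    nlinarith [sq_nonneg (inner ℝ c w + 5 / 8 * ‖w‖ ^ 2)]
  have hdir : ‖y‖⁻¹ • y ∈ robustSepDirs K p δ := by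
    refine ⟨by rw [norm_smul, norm_inv, norm_norm, inv_mul_cancel₀ hy0.ne'], fun k' hk' => ?_⟩
    obtain ⟨k, hk, hkk'⟩ := Set.mem_iUnion₂.1 hk'
    rw [mem_closedBall_iff_norm] at hkk'
    have hD := hsep k hk
    have hkR : ‖k‖ ≤ R := by simpa using hKR hk
    have hpk : ‖p - k‖ ≤ 2 * R := (norm_sub_le p k).trans (by linarith)
    -- Subtracting this multiple of `c` does not lengthen `p - k`, because `cᵀ(p - k) ≥ δ`.
    have hu : ‖(p - k) - (3 * δ / 5) • c‖ ≤ 2 * R := by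
      refine (pow_le_pow_iff_left₀ (norm_nonneg _) (by linarith) two_ne_zero).1 ?_
      have h1 : ‖p - k‖ ^ 2 ≤ (2 * R) ^ 2 := pow_le_pow_left₀ (norm_nonneg _) hpk 2
      rw [norm_sub_sq_real, real_inner_smul_right, norm_smul, hc, real_inner_comm, mul_one,
        Real.norm_eq_abs, sq_abs]
      nlinarith
    have hwu : -(ρ * (2 * R)) ≤ inner ℝ w ((p - k) - (3 * δ / 5) • c) := by
      have h1 := (abs_le.1 (abs_real_inner_le_norm w ((p - k) - (3 * δ / 5) • c))).1
      have h2 := mul_le_mul hw hu (norm_nonneg _) hρ0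
      linarith
    rw [inner_sub_right, real_inner_smul_right, real_inner_comm] at hwu
    have hyk : inner ℝ y (k' - k) ≤ ‖y‖ * (δ / 5) :=
      (real_inner_le_norm _ _).trans (mul_le_mul_of_nonneg_left hkk' hy0.le)
    have hyp : inner ℝ y (p - k) = 4 / 5 * inner ℝ c (p - k) + inner ℝ (p - k) w := by
      rw [hydef, inner_add_left, real_inner_smul_left, real_inner_comm w]
    have hw2 : ‖w‖ ^ 2 ≤ (1 / 7) ^ 2 := pow_le_pow_left₀ (norm_nonneg _) (hw.trans hρ7) 2
    have hmain : 3 * δ / 5 * ‖y‖ < inner ℝ y (p - k) := by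
      rw [hyp]
      rw [real_inner_comm] at hwu
      have h1 := mul_le_mul_of_nonneg_left hynorm (by linarith : 0 ≤ 3 * δ / 5)
      have h2 := mul_le_mul_of_nonneg_left hw2 hδ.le
      have h3 : inner ℝ w c = (inner ℝ c w : ℝ) := real_inner_comm _ _
      have h4 : inner ℝ w (p - k) = (inner ℝ (p - k) w : ℝ) := real_inner_comm _ _
      simp only [h3, h4] at hwu
      nlinarith
    have e : inner ℝ y (p - k') = (inner ℝ y (p - k) - inner ℝ y (k' - k) : ℝ) := by
      rw [← inner_sub_right]
      congr 1
      abel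
    rw [inner_sub_right] at e
    rw [real_inner_smul_left, real_inner_smul_left, inv_mul_eq_div, inv_mul_eq_div,
      lt_div_iff₀ hy0, add_mul, div_mul_cancel₀ _ hy0.ne']
    linarith
  refine ⟨?_, fun h0 => by simp [Set.mem_singleton_iff.1 h0] at hy0⟩
  have hseg := (convex_convexHull ℝ (robustSepDirs K p δ ∪ {0}))
    (subset_convexHull ℝ _ (Or.inl hdir)) (subset_convexHull ℝ _ (Or.inr rfl))
    hy0.le (by linarith : 0 ≤ 1 - ‖y‖) (by ring)
  simpa [smul_smul, hy0.ne'] using hseg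

theorem subset_nbhd {t : ℝ} (ht : 0 ≤ t) : K ⊆ nbhd K t := fun k hk =>
  Set.mem_iUnion₂.2 ⟨k, hk, Metric.mem_closedBall_self ht⟩

theorem robustSepCone_subset_sepCone (hδ : 0 < δ) : robustSepCone K p δ ⊆ sepCone K p := by
  refine Set.sdiff_subset_sdiff_left (convexHull_mono (Set.union_subset_union_left _ ?_))
  refine fun c hc => ⟨hc.1, fun k hk => ?_⟩
  have := hc.2 k (subset_nbhd (by linarith) hk)
  linarith

theorem le_volume_robustSepCone (hn : 2 ≤ n) (hδ : 0 < δ) (hδR : δ < R) (hK : Convex ℝ K)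
    (hne : K.Nonempty) (hKR : K ⊆ Metric.closedBall 0 R) (hpR : ‖p‖ ≤ R) (hp : p ∉ nbhd K δ) :
    ENNReal.ofReal ((innerRadius R δ / n) ^ n) ≤ volume (robustSepCone K p δ) := by
  obtain ⟨c, hc, hsep⟩ := exists_separator hδ hK hne hp
  have hR : 0 < R := hδ.trans hδR
  have hn0 : (0 : ℝ) < n := by exact_mod_cast (by omega : 0 < n)
  have hr : 0 < innerRadius R δ := by unfold innerRadius; positivity
  have ht : 0 ≤ innerRadius R δ / (2 * n) := by positivity
  have hsub := closedBall_subset_robustSepCone hδ hδR hKR hpR hc hsep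
    (ρ := innerRadius R δ / (2 * n) * √n) (by positivity) (by
      -- This is where `n ≥ 2` enters: `√2 > 7/5`.
      have hs : 7 / 5 ≤ √(n : ℝ) := by
        refine Real.le_sqrt_of_sq_le ?_
        have : (2 : ℝ) ≤ n := by exact_mod_cast hn
        linarith
      have hss : √(n : ℝ) * √n = n := Real.mul_self_sqrt hn0.le
      have e : 7 * (innerRadius R δ / (2 * n) * √n * R) = 7 / 5 * √n * δ / n := by
        rw [innerRadius]
        field_simp
      rw [e, div_le_iff₀ hn0]
      nlinarith [mul_le_mul_of_nonneg_right hs (Real.sqrt_nonneg (n : ℝ))])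
  refine le_trans ?_ (measure_mono hsub)
  refine le_trans (le_of_eq ?_) (volume_le_volume_closedBall _ ht)
  rw [← ENNReal.ofReal_pow (by positivity)]
  congr 2
  field_simp

/-- The main term `(p - k)ᵀd` exceeds `2δ/5`. The correction `cᵀ(p - k) · cᵀd` is at most `δ/5`: if
`cᵀ(p - k) ≥ 0` because the oracle answer was rejected, and if both factors are negative by the
bound on `-cᵀd`. -/
theorem inner_cutNormal_nonneg {c d k : Vec n} (hδ : 0 < δ) (hδR : δ < R)
    (hKR : K ⊆ Metric.closedBall 0 R) (hpR : ‖p‖ ≤ R) (hc : ‖c‖ = 1)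
    (hd : d ∈ robustSepDirs K p δ) (hk : k ∈ nbhd K (δ / 5))
    (hrej : ¬ (inner ℝ c k + δ / 5 ≤ inner ℝ c p))
    (hcd : -inner ℝ c d ≤ (δ / (5 * R)) / (1 + δ / (5 * R)) / 2) :
    0 ≤ inner ℝ (cutNormal p k c) d := by
  have hR : 0 < R := hδ.trans hδR
  have h1 := hd.2 k hk
  have hX : inner ℝ c (p - k) < δ / 5 := by
    rw [inner_sub_right]
    linarith
  have hY : 2 * δ / 5 < inner ℝ (p - k) d := by
    rw [real_inner_comm, inner_sub_right]
    linarith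
  have hcd1 : |inner ℝ c d| ≤ 1 := by simpa [hc, hd.1] using abs_real_inner_le_norm c d
  rw [cutNormal, inner_sub_left, real_inner_smul_left]
  set X : ℝ := inner ℝ c (p - k)
  set e : ℝ := inner ℝ c d
  obtain ⟨he1, he2⟩ := abs_le.1 hcd1
  rcases le_or_gt 0 X with hX0 | hX0
  · nlinarith
  rcases le_or_gt 0 e with he0 | he0
  · nlinarith
  have hnorm : ‖p - k‖ ≤ 2 * R + δ / 5 := by
    obtain ⟨k₀, hk₀, hkk₀⟩ := Set.mem_iUnion₂.1 hk
    rw [mem_closedBall_iff_norm] at hkk₀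
    have h2 : ‖k₀‖ ≤ R := by simpa using hKR hk₀
    have h3 := norm_sub_le p k
    have h4 := norm_add_le (k - k₀) k₀
    rw [sub_add_cancel] at h4
    linarith
  have hXl : -X ≤ 2 * R + δ / 5 := by
    have := (abs_le.1 (abs_real_inner_le_norm c (p - k))).1
    rw [hc, one_mul] at this
    change -‖p - k‖ ≤ X at this
    linarith
  have hprod : -e * -X ≤ (δ / (5 * R)) / (1 + δ / (5 * R)) / 2 * (2 * R + δ / 5) :=
    mul_le_mul hcd hXl (by linarith) (by positivity)
  have hval : (δ / (5 * R)) / (1 + δ / (5 * R)) / 2 * (2 * R + δ / 5) ≤ δ / 5 := by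
    have e1 : (δ / (5 * R)) / (1 + δ / (5 * R)) / 2 * (2 * R + δ / 5) =
        δ * (2 * R + δ / 5) / (2 * (5 * R + δ)) := by
      field_simp
    rw [e1, div_le_iff₀ (by positivity)]
    nlinarith [sq_nonneg δ]
  linarith

end Cone

/-! ### Sequences of cuts with growing determinant -/

section Good

variable {n : ℕ}

/-- The matrix `I + ∑ aᵢ aᵢᵀ / κᵢ²` of a list of cuts. -/
def gram (a : ℕ → Vec n) (κ : ℕ → ℝ) : List ℕ → Matrix (Fin n) (Fin n) ℝ
  | [] => 1
  | i :: L => gram a κ L + ((κ i) ^ 2)⁻¹ • Matrix.vecMulVec (a i).ofLp (a i).ofLp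

/-- Every cut of the list, read from right to left, is long in the norm of the inverse of the matrix
of the preceding ones. -/
def Growing (c : ℝ) (a : ℕ → Vec n) (κ : ℕ → ℝ) : List ℕ → Prop
  | [] => True
  | i :: L => Growing c a κ L ∧ i ∉ L ∧
      ∃ v ≠ 0, c * quad (gram a κ L) v ≤ ((κ i) ^ 2)⁻¹ * (inner ℝ (a i) v) ^ 2

variable {a a' : ℕ → Vec n} {κ κ' : ℕ → ℝ} {c : ℝ} {L L' : List ℕ}

theorem posDef_gram (a : ℕ → Vec n) (κ : ℕ → ℝ) (L : List ℕ) : (gram a κ L).PosDef := by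
  induction L with
  | nil => exact Matrix.PosDef.one
  | cons i L ih => exact posDef_smul_vecMulVec_add ih (by positivity) _

theorem quad_gram_cons (i : ℕ) (v : Vec n) :
    quad (gram a κ (i :: L)) v = quad (gram a κ L) v + ((κ i) ^ 2)⁻¹ * (inner ℝ (a i) v) ^ 2 := by
  rw [gram, quad_add_left, quad_smul_left, quad_vecMulVec]

theorem quad_gram_le_of_sublist (h : L'.Sublist L) (v : Vec n) :
    quad (gram a κ L') v ≤ quad (gram a κ L) v := by
  induction h with
  | slnil => exact le_rfl
  | cons i _ ih =>
    rw [quad_gram_cons]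
    have : 0 ≤ ((κ i) ^ 2)⁻¹ * (inner ℝ (a i) v) ^ 2 := by positivity
    linarith
  | cons_cons i _ ih =>
    rw [quad_gram_cons, quad_gram_cons]
    linarith

theorem gram_congr (h : ∀ i ∈ L, a i = a' i ∧ κ i = κ' i) : gram a κ L = gram a' κ' L := by
  induction L with
  | nil => rfl
  | cons i L ih =>
    rw [List.forall_mem_cons] at h
    rw [gram, gram, ih h.2, h.1.1, h.1.2]

theorem Growing.congr (hL : Growing c a κ L) (h : ∀ i ∈ L, a i = a' i ∧ κ i = κ' i) :
    Growing c a' κ' L := by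
  induction L with
  | nil => trivial
  | cons i L ih =>
    rw [List.forall_mem_cons] at h
    obtain ⟨h1, h2, v, hv, h3⟩ := hL
    refine ⟨ih h1 h.2, h2, v, hv, ?_⟩
    rwa [← gram_congr h.2, ← h.1.1, ← h.1.2]

/-- Dropping cuts only decreases the form `gram`, so the same witness `v` still works. With
witnesses in place of inverse matrices, no antitonicity of inversion is needed. -/
theorem Growing.sublist (hc : 0 ≤ c) (hL : Growing c a κ L) (h : L'.Sublist L) :
    Growing c a κ L' := by
  induction h with
  | slnil => trivial
  | cons i _ ih => exact ih hL.1
  | cons_cons i h ih =>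
    obtain ⟨h1, h2, v, hv, h3⟩ := hL
    exact ⟨ih h1, fun hi => h2 (h.subset hi), v, hv,
      (mul_le_mul_of_nonneg_left (quad_gram_le_of_sublist h v) hc).trans h3⟩

theorem Growing.nodup (hL : Growing c a κ L) : L.Nodup := by
  induction L with
  | nil => exact List.nodup_nil
  | cons i L ih => exact List.nodup_cons.2 ⟨hL.2.1, ih hL.1⟩

theorem Growing.pow_length_le_det (hc : 0 ≤ c) (hL : Growing c a κ L) :
    (1 + c) ^ L.length ≤ (gram a κ L).det := by
  induction L with
  | nil => simp [gram]
  | cons i L ih =>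
    obtain ⟨h1, -, v, hv, h3⟩ := hL
    rw [List.length_cons, pow_succ']
    exact (mul_le_mul_of_nonneg_left (ih h1) (by linarith)).trans
      (mul_det_le_det_add_smul_vecMulVec (posDef_gram a κ L) (by positivity) (a i) hv h3)

theorem quad_gram_le_four_mul_quad_hess (S : Cuts n) {z : Vec n} (hz : z ∈ S.domain)
    (hnd : L.Nodup) (hLS : ∀ i ∈ L, i ∈ S.idx) (hκ : ∀ i ∈ L, 0 < κ i)
    (hs : ∀ i ∈ L, S.slack i z ≤ 2 * κ i) (v : Vec n) :
    quad (gram S.a κ L) v ≤ 4 * quad (S.hess z) v := by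
  have e : quad (gram S.a κ L) v =
      ‖v‖ ^ 2 + ∑ i ∈ L.toFinset, ((κ i) ^ 2)⁻¹ * (inner ℝ (S.a i) v) ^ 2 := by
    rw [List.sum_toFinset _ hnd]
    clear hnd hLS hκ hs
    induction L with
    | nil => simp [gram, quad_one]
    | cons i L ih =>
      rw [quad_gram_cons, ih, List.map_cons, List.sum_cons]
      ring
  have hA := S.one_sub_norm_sq_pos hz
  have h1 : ∑ i ∈ L.toFinset, ((κ i) ^ 2)⁻¹ * (inner ℝ (S.a i) v) ^ 2 ≤
      ∑ i ∈ S.idx, 4 * (inner ℝ (S.a i) v / S.slack i z) ^ 2 := by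
    refine (Finset.sum_le_sum fun i hi => ?_).trans (Finset.sum_le_sum_of_subset_of_nonneg
      (fun i hi => hLS i (List.mem_toFinset.1 hi)) fun i _ _ => by positivity)
    rw [List.mem_toFinset] at hi
    have hpos := S.slack_pos hz (hLS i hi)
    have h2 : (S.slack i z) ^ 2 ≤ 4 * (κ i) ^ 2 := by
      have := pow_le_pow_left₀ hpos.le (hs i hi) 2
      linarith
    have hk := hκ i hi
    have h3 : ((κ i) ^ 2)⁻¹ ≤ 4 * ((S.slack i z) ^ 2)⁻¹ := by
      rw [← div_eq_mul_inv, le_div_iff₀ (by positivity), inv_mul_le_iff₀ (by positivity)]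
      linarith
    calc ((κ i) ^ 2)⁻¹ * (inner ℝ (S.a i) v) ^ 2
        ≤ 4 * ((S.slack i z) ^ 2)⁻¹ * (inner ℝ (S.a i) v) ^ 2 :=
          mul_le_mul_of_nonneg_right h3 (sq_nonneg _)
      _ = 4 * (inner ℝ (S.a i) v / S.slack i z) ^ 2 := by rw [div_pow]; ring
  have h4 : ‖v‖ ^ 2 ≤ 2 / (1 - ‖z‖ ^ 2) * ‖v‖ ^ 2 := by
    refine le_mul_of_one_le_left (sq_nonneg _) ?_
    rw [le_div_iff₀ hA]
    nlinarith [sq_nonneg ‖z‖]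
  have h5 : 0 ≤ 4 / (1 - ‖z‖ ^ 2) ^ 2 * (inner ℝ z v) ^ 2 := by positivity
  rw [e, S.quad_hess]
  rw [← Finset.mul_sum] at h1
  nlinarith [sq_nonneg ‖v‖]

/-- The witness is `H⁻¹aᵢ`, the direction of equality in Cauchy–Schwarz: both `aᵢᵀv` and `quad H v`
are then `quad H⁻¹ (a i)`. -/
theorem Growing.cons {H : Matrix (Fin n) (Fin n) ℝ} {i : ℕ} (hL : Growing c a κ L) (hi : i ∉ L)
    (hH : H.PosDef) (hle : ∀ v, quad (gram a κ L) v ≤ 4 * quad H v) (hc : 0 < c) (hκ : 0 < κ i)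
    (hq : 4 * c * (κ i) ^ 2 ≤ quad H⁻¹ (a i)) : Growing c a κ (i :: L) := by
  have hQ : 0 < quad H⁻¹ (a i) := lt_of_lt_of_le (by positivity) hq
  refine ⟨hL, hi, WithLp.toLp 2 (H⁻¹ *ᵥ (a i).ofLp), fun h0 => ?_, ?_⟩
  · have := quad_inv_mulVec hH (a i)
    rw [h0] at this
    simp [quad] at this
    rw [quad] at hQ
    linarith
  · have h1 := hle (WithLp.toLp 2 (H⁻¹ *ᵥ (a i).ofLp))
    rw [quad_inv_mulVec hH] at h1
    rw [inner_inv_mulVec, inv_mul_eq_div, le_div_iff₀ (by positivity)]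
    have h2 := mul_le_mul_of_nonneg_left h1 (by positivity : 0 ≤ c * (κ i) ^ 2)
    nlinarith [mul_le_mul_of_nonneg_right hq hQ.le]

end Good

/-! ### Invariants of the algorithm -/

section Invariant

variable {n : ℕ} {C : Constants} {K : Set (Vec n)} {R δ : ℝ} {p : Vec n} {c : ℝ}

/-- What holds in every state of the algorithm. A cut that is missing from the growing sequence `L`
is due for a reset, and the sequence is complete whenever a cut is discarded or added. -/
structure Invariant (C : Constants) (K : Set (Vec n)) (R δ : ℝ) (p : Vec n) (c : ℝ)
    (s : State n) : Prop where
  centre : IsApproxCentre C R δ s.cuts s.z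
  offset_nonpos : ∀ i ∈ s.cuts.idx, s.cuts.b i ≤ 0
  normal_nonneg : ∀ i ∈ s.cuts.idx, ∀ d ∈ robustSepDirs K p δ, 0 ≤ inner ℝ (s.cuts.a i) d
  kappa_pos : ∀ i ∈ s.cuts.idx, 0 < s.κ i
  exists_growing : ∃ L : List ℕ, Growing c s.cuts.a s.κ L ∧ (∀ i ∈ L, i ∈ s.cuts.idx) ∧
    ∀ i ∈ s.cuts.idx, i ∉ L →
      2 < s.mu i ∧ ∀ j ∈ s.cuts.idx, 2 < s.mu j → C.σ₀ ≤ s.cuts.sigma j s.z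

theorem IsApproxCentre.norm_pos {S : Cuts n} {z : Vec n} (h : IsApproxCentre C R δ S z) :
    0 < ‖z‖ := by
  by_contra! h0
  have h1 := h.2.2
  rw [le_antisymm h0 (norm_nonneg z)] at h1
  have := qFun_nonneg (S.newtonDecrement_nonneg z) (h.2.1.trans C.ρ₀_lt)
  simp at h1
  linarith

theorem IsApproxCentre.neg_inner_query_le {s : State n} (h : IsApproxCentre C R δ s.cuts s.z)
    {d : Vec n} (hd : ‖d‖ = 1) (ha : ∀ i ∈ s.cuts.idx, 0 ≤ inner ℝ (s.cuts.a i) d) :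
    -inner ℝ s.query d ≤ (δ / (5 * R)) / (1 + δ / (5 * R)) / 2 := by
  have hz := h.norm_pos
  have h1 := s.cuts.neg_inner_mul_sqrt_two_le h.1 (h.2.1.trans C.ρ₀_lt) hd ha
  have h2 := h1.trans h.2.2.le
  have h3 : √2 * √2 = (2 : ℝ) := Real.mul_self_sqrt (by norm_num)
  have h4 : (0 : ℝ) < √2 := by positivity
  rw [State.query, real_inner_smul_left, ← mul_neg, inv_mul_eq_div, div_le_iff₀ hz]
  rw [← mul_div_assoc, le_div_iff₀ h4, mul_assoc, h3] at h2
  linarith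

/-- The initial `z` is an exact centre, since `1/s = 2s/(1 - s²)` at `s = 1/√3`. The first cut has
`aᵀa/κ² = 3`, hence `c ≤ 3`, and it respects `M_p'` because `0 ∈ K`. -/
theorem invariant_initState (hp : p ≠ 0) (hδ : 0 < δ) (hδR : δ < R) (h0 : (0 : Vec n) ∈ K)
    (hc : c ≤ 3) : Invariant C K R δ p c (initState p) := by
  have hR : 0 < R := hδ.trans hδR
  have hpn : 0 < ‖p‖ := norm_pos_iff.2 hp
  set a : Vec n := ‖p‖⁻¹ • p with ha
  have han : ‖a‖ = 1 := by rw [ha, norm_smul, norm_inv, norm_norm, inv_mul_cancel₀ hpn.ne']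
  have haa : inner ℝ a a = (1 : ℝ) := by rw [real_inner_self_eq_norm_sq, han]; norm_num
  have h3 : (0 : ℝ) < √3 := by positivity
  have h33 : √3 ^ 2 = (3 : ℝ) := Real.sq_sqrt (by norm_num)
  have hzn : ‖(1 / √3) • a‖ = 1 / √3 := by
    rw [norm_smul, han, mul_one, Real.norm_of_nonneg (by positivity)]
  have hz2 : ‖(1 / √3) • a‖ ^ 2 = 1 / 3 := by rw [hzn, div_pow, h33]; norm_num
  have hslack : (initState p).cuts.slack 0 (initState p).z = 1 / √3 := by
    simp [initState, Cuts.slack, ← ha, real_inner_smul_right, han]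
  have hgrad : (initState p).cuts.grad (initState p).z = 0 := by
    have : (initState p).cuts.grad (initState p).z =
        -(((1 / √3)⁻¹) • a) + (2 / (1 - ‖(1 / √3) • a‖ ^ 2)) • (1 / √3) • a := by
      rw [← hslack, Cuts.grad]
      change -(∑ i ∈ {0}, _) + _ = _
      rw [Finset.sum_singleton, hslack]
      rfl
    have h0 : -(1 / √3)⁻¹ + 2 / (1 - 1 / 3) * (1 / √3) = (0 : ℝ) := by
      field_simp
      rw [h33]
      norm_num
    calc _ = (-(1 / √3)⁻¹ + 2 / (1 - 1 / 3) * (1 / √3)) • a := by rw [this, hz2]; module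
      _ = 0 := by rw [h0, zero_smul]
  have hdec : (initState p).cuts.newtonDecrement (initState p).z = 0 := by
    simp [Cuts.newtonDecrement, hgrad, quad]
  refine ⟨⟨⟨?_, ?_⟩, ?_, ?_⟩, ?_, ?_, ?_, [0], ?_, ?_, ?_⟩
  · change ‖(1 / √3) • a‖ < 1
    have := norm_nonneg ((1 / √3) • a)
    nlinarith
  · intro i hi
    have hi0 : i = 0 := by simpa [initState] using hi
    rw [hi0]
    have h : 0 < (initState p).cuts.slack 0 (initState p).z := by rw [hslack]; positivity
    rw [Cuts.slack] at h
    linarith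
  · rw [hdec]
    exact C.ρ₀_pos
  · rw [hdec]
    change qFun 0 < _ * (‖(1 / √3) • a‖ / _)
    rw [hzn, qFun]
    simp only [mul_zero, sub_zero, Real.one_rpow, sub_self]
    positivity
  · intro i _
    exact le_rfl
  · intro i _ d hd
    change 0 ≤ inner ℝ a d
    have h := hd.2 0 (subset_nbhd (by linarith) h0)
    rw [inner_zero_right] at h
    rw [ha, real_inner_smul_left, real_inner_comm]
    have : 0 ≤ ‖p‖⁻¹ := by positivity
    exact mul_nonneg this (by linarith)
  · intro i _
    change 0 < 1 / √3
    positivity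
  · refine ⟨trivial, by simp, a, fun h => by simp [h] at han, ?_⟩
    change c * quad 1 a ≤ ((1 / √3) ^ 2)⁻¹ * (inner ℝ a a) ^ 2
    rw [quad_one, han, haa, div_pow, h33]
    norm_num
    exact hc
  · simp [initState]
  · intro i hi hiL
    simp [initState] at hi hiL
    exact absurd hi hiL

theorem Invariant.slack_le {s : State n} (hs : Invariant C K R δ p c s) {i : ℕ}
    (hi : i ∈ s.cuts.idx) (hμ : s.mu i ≤ 2) : s.cuts.slack i s.z ≤ 2 * s.κ i := by
  rwa [State.mu, div_le_iff₀ (hs.kappa_pos i hi)] at hμ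

theorem Invariant.discard {s : State n} (hs : Invariant C K R δ p c s) (hc : 0 ≤ c) {j : ℕ}
    {z' : Vec n} (hj : j ∈ s.cuts.idx) (hμ : 2 < s.mu j) (hσ : s.cuts.sigma j s.z < C.σ₀)
    (hz' : IsApproxCentre C R δ (s.cuts.discard j) z') :
    Invariant C K R δ p c { cuts := s.cuts.discard j, κ := s.κ, z := z' } := by
  obtain ⟨L, hL, hLS, hcomp⟩ := hs.exists_growing
  -- A missing cut would certify that nothing can be discarded, contrary to `hσ`.
  have hall : ∀ i ∈ s.cuts.idx, i ∈ L := fun i hi => by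
    by_contra hiL
    exact absurd ((hcomp i hi hiL).2 j hj hμ) (not_le.2 hσ)
  refine ⟨hz', fun i hi => hs.offset_nonpos i (Finset.mem_of_mem_erase hi),
    fun i hi => hs.normal_nonneg i (Finset.mem_of_mem_erase hi),
    fun i hi => hs.kappa_pos i (Finset.mem_of_mem_erase hi), L.erase j,
    hL.sublist hc List.erase_sublist, fun i hi => ?_, fun i hi hiL => ?_⟩
  · rw [hL.nodup.mem_erase_iff] at hi
    exact Finset.mem_erase.2 ⟨hi.1, hLS i hi.2⟩
  · obtain ⟨h1, h2⟩ := Finset.mem_erase.1 hi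
    exact absurd (hL.nodup.mem_erase_iff.2 ⟨h1, hall i h2⟩) hiL

theorem Invariant.reset {s : State n} (hs : Invariant C K R δ p c s) (hc : 0 < c)
    (hcσ : 4 * c ≤ C.σ₀) {j : ℕ}
    (hno : ∀ i ∈ s.cuts.idx, 2 < s.mu i → C.σ₀ ≤ s.cuts.sigma i s.z)
    (hj : j ∈ s.cuts.idx) (hμ : 2 < s.mu j) :
    Invariant C K R δ p c
      { cuts := s.cuts, κ := Function.update s.κ j (s.cuts.slack j s.z), z := s.z } := by
  classical
  obtain ⟨L, hL, hLS, hcomp⟩ := hs.exists_growing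
  have hpos := s.cuts.slack_pos hs.centre.1 hj
  -- All cuts with an outdated `κ` leave the sequence, so that its matrix is controlled by the
  -- Hessian at `z`. They are recovered by later resets, during which `z` and the `σᵢ` do not
  -- change.
  set L' := L.filter (fun i => s.mu i ≤ 2) with hL'
  have hmem : ∀ i, i ∈ L' ↔ i ∈ L ∧ s.mu i ≤ 2 := fun i => by simp [hL']
  have hL'g : Growing c s.cuts.a s.κ L' := hL.sublist hc.le List.filter_sublist
  have hjL' : j ∉ L' := fun h => not_le.2 hμ ((hmem j).1 h).2
  have hne : ∀ i ∈ L', i ≠ j := fun i hi h => hjL' (h ▸ hi)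
  have hcongr : ∀ i ∈ L', s.cuts.a i = s.cuts.a i ∧
      s.κ i = Function.update s.κ j (s.cuts.slack j s.z) i := fun i hi =>
    ⟨rfl, (Function.update_of_ne (hne i hi) _ _).symm⟩
  refine ⟨hs.centre, hs.offset_nonpos, hs.normal_nonneg, fun i hi => ?_, j :: L', ?_, ?_, ?_⟩
  · by_cases hij : i = j
    · subst hij
      simpa using hpos
    · simpa [Function.update_of_ne hij] using hs.kappa_pos i hi
  · refine (hL'g.congr hcongr).cons hjL' (s.cuts.posDef_hess hs.centre.1) (fun v => ?_) hc
      (by simpa using hpos) ?_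
    · rw [← gram_congr hcongr]
      exact quad_gram_le_four_mul_quad_hess s.cuts hs.centre.1 hL'g.nodup
        (fun i hi => hLS i ((hmem i).1 hi).1)
        (fun i hi => hs.kappa_pos i (hLS i ((hmem i).1 hi).1))
        (fun i hi => hs.slack_le (hLS i ((hmem i).1 hi).1) ((hmem i).1 hi).2) v
    · have h := hno j hj hμ
      rw [Cuts.sigma, le_div_iff₀ (by positivity)] at h
      simp only [Function.update_self]
      exact (mul_le_mul_of_nonneg_right hcσ (sq_nonneg _)).trans h
  · intro i hi
    rcases List.mem_cons.1 hi with rfl | hi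
    · exact hj
    · exact hLS i ((hmem i).1 hi).1
  · intro i hi hiL
    have hij : i ≠ j := fun h => hiL (by simp [h])
    have hμi : 2 < s.mu i := by
      by_contra! hle
      by_cases hiL2 : i ∈ L
      · exact hiL (List.mem_cons_of_mem _ ((hmem i).2 ⟨hiL2, hle⟩))
      · exact absurd (hcomp i hi hiL2).1 (not_lt.2 hle)
    have hmu : ∀ k, k ≠ j → State.mu ⟨s.cuts, Function.update s.κ j (s.cuts.slack j s.z), s.z⟩ k =
        s.mu k := fun k hk => by
      simp [State.mu, Function.update_of_ne hk]
    refine ⟨(hmu i hij).symm ▸ hμi, fun k hk hμk => ?_⟩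
    by_cases hkj : k = j
    · exact hkj ▸ hno j hj hμ
    · exact hno k hk (hmu k hkj ▸ hμk)

theorem inner_cutNormal_self {p k c : Vec n} (hc : ‖c‖ = 1) : inner ℝ (cutNormal p k c) c = (0 : ℝ) := by
  rw [cutNormal, inner_sub_left, real_inner_smul_left, real_inner_self_eq_norm_sq, hc,
    real_inner_comm]
  ring

theorem Invariant.add {s : State n} (hs : Invariant C K R δ p c s) (hδ : 0 < δ) (hδR : δ < R)
    (hKR : K ⊆ Metric.closedBall 0 R) (hpR : ‖p‖ ≤ R) (hc : 0 < c)
    (hcγ : 4 * c * (1 + 7 * C.γ₀) ^ 2 ≤ C.γ₀ ^ 2) {k a : Vec n} {β : ℝ} {j : ℕ} {z' : Vec n}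
    (hμ : ∀ i ∈ s.cuts.idx, s.mu i ≤ 2) (hk : IsWOptAnswer K s.query (δ / 5) k)
    (hrej : ¬ (inner ℝ s.query k + δ / 5 ≤ inner ℝ s.query p))
    (ha : a = ‖cutNormal p k s.query‖⁻¹ • cutNormal p k s.query) (hβ : β < 0)
    (hγ : quad (s.cuts.hess s.z)⁻¹ a / (inner ℝ a s.z - β) ^ 2 = C.γ₀ ^ 2)
    (hj : j ∉ s.cuts.idx) (hz' : IsApproxCentre C R δ (s.cuts.add j a β) z') :
    Invariant C K R δ p c { cuts := s.cuts.add j a β,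
                            κ := Function.update s.κ j (inner ℝ a z' - β), z := z' } := by
  have hzn := hs.centre.norm_pos
  have hq : ‖s.query‖ = 1 := by
    rw [State.query, norm_smul, norm_inv, norm_norm, inv_mul_cancel₀ hzn.ne']
  -- The normal is orthogonal to `z`, so `β < 0` makes the cut shallow: `z` has positive slack.
  have haz : inner ℝ a s.z = (0 : ℝ) := by
    have e : s.z = ‖s.z‖ • s.query := by rw [State.query, smul_smul, mul_inv_cancel₀ hzn.ne', one_smul]
    rw [e, ha, real_inner_smul_left, real_inner_smul_right, inner_cutNormal_self hq]
    simp
  have hslack : 0 < inner ℝ a s.z - β := by rw [haz]; linarith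
  have hκ : 0 < inner ℝ a z' - β := by
    have := hz'.1.2 j (Finset.mem_insert_self _ _)
    simp [Cuts.add] at this
    linarith
  have hne : ∀ i ∈ s.cuts.idx, i ≠ j := fun i hi h => hj (h ▸ hi)
  have hle : inner ℝ a z' - β ≤ (1 + 7 * C.γ₀) * (inner ℝ a s.z - β) :=
    Cuts.slack_le_of_add hj hs.centre.1 hz'.1 (hs.centre.2.1.trans C.ρ₀_lt).le
      (hz'.2.1.trans C.ρ₀_lt).le hslack C.γ₀_pos.le hγ
  obtain ⟨L, hL, hLS, hcomp⟩ := hs.exists_growing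
  have hall : ∀ i ∈ s.cuts.idx, i ∈ L := fun i hi => by
    by_contra hiL
    exact absurd (hcomp i hi hiL).1 (not_lt.2 (hμ i hi))
  have hcongr : ∀ i ∈ L, s.cuts.a i = Function.update s.cuts.a j a i ∧
      s.κ i = Function.update s.κ j (inner ℝ a z' - β) i := fun i hi =>
    ⟨(Function.update_of_ne (hne i (hLS i hi)) _ _).symm,
      (Function.update_of_ne (hne i (hLS i hi)) _ _).symm⟩
  refine ⟨hz', fun i hi => ?_, fun i hi d hd => ?_, fun i hi => ?_, j :: L, ?_, ?_, ?_⟩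
  · rcases Finset.mem_insert.1 hi with rfl | hi
    · simpa [Cuts.add] using hβ.le
    · simpa [Cuts.add, Function.update_of_ne (hne i hi)] using hs.offset_nonpos i hi
  · rcases Finset.mem_insert.1 hi with rfl | hi
    · have h := inner_cutNormal_nonneg hδ hδR hKR hpR hq hd hk.1 hrej
        (hs.centre.neg_inner_query_le hd.1 fun i hi => hs.normal_nonneg i hi d hd)
      simp only [Cuts.add, Function.update_self]
      rw [ha, real_inner_smul_left]
      exact mul_nonneg (by positivity) h
    · simpa [Cuts.add, Function.update_of_ne (hne i hi)] using hs.normal_nonneg i hi d hd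
  · rcases Finset.mem_insert.1 hi with rfl | hi
    · simpa using hκ
    · simpa [Function.update_of_ne (hne i hi)] using hs.kappa_pos i hi
  · refine (hL.congr hcongr).cons (fun h => hj (hLS j h)) (s.cuts.posDef_hess hs.centre.1)
      (fun v => ?_) hc (by simpa using hκ) ?_
    · change quad (gram (Function.update s.cuts.a j a) _ L) v ≤ _
      rw [← gram_congr hcongr]
      exact quad_gram_le_four_mul_quad_hess s.cuts hs.centre.1 hL.nodup hLS
        (fun i hi => hs.kappa_pos i (hLS i hi)) (fun i hi => hs.slack_le (hLS i hi) (hμ i (hLS i hi))) v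
    · rw [div_eq_iff (by positivity)] at hγ
      simp only [Function.update_self]
      rw [hγ]
      calc 4 * c * (inner ℝ a z' - β) ^ 2
          ≤ 4 * c * ((1 + 7 * C.γ₀) * (inner ℝ a s.z - β)) ^ 2 := by gcongr
        _ = 4 * c * (1 + 7 * C.γ₀) ^ 2 * (inner ℝ a s.z - β) ^ 2 := by ring
        _ ≤ _ := mul_le_mul_of_nonneg_right hcγ (sq_nonneg _)
  · intro i hi
    rcases List.mem_cons.1 hi with rfl | hi
    · exact Finset.mem_insert_self _ _
    · exact Finset.mem_insert_of_mem (hLS i hi)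
  · intro i hi hiL
    exfalso
    rcases Finset.mem_insert.1 hi with rfl | hi
    · exact hiL (by simp)
    · exact hiL (List.mem_cons_of_mem _ (hall i hi))

theorem Invariant.step {s t : State n} (hs : Invariant C K R δ p c s) (hδ : 0 < δ) (hδR : δ < R)
    (hKR : K ⊆ Metric.closedBall 0 R) (hpR : ‖p‖ ≤ R) (hc : 0 < c) (hcσ : 4 * c ≤ C.σ₀)
    (hcγ : 4 * c * (1 + 7 * C.γ₀) ^ 2 ≤ C.γ₀ ^ 2) (hst : Step C K R δ p s t) :
    Invariant C K R δ p c t := by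
  cases hst with
  | discard j z' hj hμ hσ hz' => exact hs.discard hc.le hj hμ hσ hz'
  | reset j hno hj hμ => exact hs.reset hc hcσ hno hj hμ
  | add k a β j z' hμ hk hrej hne ha hβ hγ hj hz' =>
    exact hs.add hδ hδR hKR hpR hc hcγ hμ hk hrej ha hβ hγ hj hz'

theorem Reachable.invariant {H : ℝ} {s : State n} (hδ : 0 < δ) (hδR : δ < R)
    (h0 : (0 : Vec n) ∈ K) (hKR : K ⊆ Metric.closedBall 0 R) (hp : p ≠ 0) (hpR : ‖p‖ ≤ R)
    (hc : 0 < c) (hc3 : c ≤ 3) (hcσ : 4 * c ≤ C.σ₀)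
    (hcγ : 4 * c * (1 + 7 * C.γ₀) ^ 2 ≤ C.γ₀ ^ 2) (hs : Reachable C K R δ p H s) :
    Invariant C K R δ p c s := by
  induction hs with
  | init => exact invariant_initState hp hδ hδR h0 hc3
  | step s t _ _ hst ih => exact ih.step hδ hδR hKR hpR hc hcσ hcγ hst

/-! ### Consequences of the invariant, and the threshold -/

theorem convex_region (S : Cuts n) : Convex ℝ S.region := by
  have e : S.region = Metric.closedBall 0 1 ∩ ⋂ i ∈ S.idx, {x | S.b i ≤ inner ℝ (S.a i) x} := by
    ext x
    simp [Cuts.region]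
  rw [e]
  refine (convex_closedBall 0 1).inter (convex_iInter₂ fun i _ => ?_)
  exact convex_halfSpace_ge (innerSL ℝ (S.a i)).toLinearMap.isLinear _

theorem Invariant.robustSepCone_subset {s : State n} (hs : Invariant C K R δ p c s) :
    robustSepCone K p δ ⊆ s.cuts.region := by
  refine Set.sdiff_subset.trans (convexHull_min ?_ (convex_region s.cuts))
  rintro d (hd | rfl)
  · exact ⟨hd.1.le, fun i hi => (hs.offset_nonpos i hi).trans (hs.normal_nonneg i hi d hd)⟩
  · exact ⟨by simp, fun i hi => by simpa using hs.offset_nonpos i hi⟩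

theorem Invariant.region_subset_ellipsoid {s : State n} (hs : Invariant C K R δ p c s)
    (hh : 1 ≤ s.cuts.h) :
    s.cuts.region ⊆ ellipsoid (s.cuts.hess s.z) s.z (6 * s.cuts.h) :=
  s.cuts.region_subset_ellipsoid hs.centre.1 (hs.centre.2.1.trans C.ρ₀_lt_one_div).le hh

/-- With all `μᵢ ≤ 2` the growing sequence contains every cut. Passing from the Hessian to `gram`
costs a factor `4` in the form, so the radius grows from `6h` to `12h`, and `24h` is the side of the
enclosing cube. -/
theorem Invariant.volume_region_le {s : State n} (hs : Invariant C K R δ p c s) (hc : 0 ≤ c)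
    (hh : 1 ≤ s.cuts.h) (hμ : ∀ i ∈ s.cuts.idx, s.mu i ≤ 2) :
    volume s.cuts.region ≤
      ENNReal.ofReal ((24 * s.cuts.h) ^ n / √((1 + c) ^ s.cuts.h)) := by
  obtain ⟨L, hL, hLS, hcomp⟩ := hs.exists_growing
  have hlen : s.cuts.h ≤ L.length := by
    rw [← List.toFinset_card_of_nodup hL.nodup, Cuts.h]
    refine Finset.card_le_card fun i hi => List.mem_toFinset.2 ?_
    by_contra hiL
    exact absurd (hcomp i hi hiL).1 (not_lt.2 (hμ i hi))
  have hsub : s.cuts.region ⊆ ellipsoid (gram s.cuts.a s.κ L) s.z (12 * s.cuts.h) := by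
    intro x hx
    have h1 : quad (s.cuts.hess s.z) (x - s.z) ≤ _ := hs.region_subset_ellipsoid hh hx
    have h2 := quad_gram_le_four_mul_quad_hess s.cuts hs.centre.1 hL.nodup hLS
      (fun i hi => hs.kappa_pos i (hLS i hi)) (fun i hi => hs.slack_le (hLS i hi) (hμ i (hLS i hi)))
      (x - s.z)
    change quad _ (x - s.z) ≤ _
    linarith
  refine (measure_mono hsub).trans ((volume_ellipsoid_le (posDef_gram _ _ L) s.z
    (by positivity)).trans (ENNReal.ofReal_le_ofReal ?_))
  have hdet : (1 + c) ^ s.cuts.h ≤ (gram s.cuts.a s.κ L).det :=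
    (pow_le_pow_right₀ (by linarith) hlen).trans (hL.pow_length_le_det hc)
  have e : (2 * (12 * s.cuts.h) : ℝ) = 24 * s.cuts.h := by ring
  rw [e]
  gcongr

/-- When the number of cuts reaches the threshold, the last step has added a cut. -/
theorem Reachable.exists_last_add {H : ℝ} {t : State n} (ht : Reachable C K R δ p H t)
    (hH : 1 < H) (hth : H ≤ t.cuts.h) :
    ∃ s, Reachable C K R δ p H s ∧ (s.cuts.h : ℝ) < H ∧ H ≤ s.cuts.h + 1 ∧
      (∀ i ∈ s.cuts.idx, s.mu i ≤ 2) ∧ t.cuts.region ⊆ s.cuts.region := by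
  cases ht with
  | init =>
    simp [initState, Cuts.h] at hth
    linarith
  | step s _ hs hlt hst =>
    cases hst with
    | discard j z' hj hμ hσ hz' =>
      have : (s.cuts.discard j).h ≤ s.cuts.h := Finset.card_le_card (Finset.erase_subset _ _)
      have : ((s.cuts.discard j).h : ℝ) ≤ s.cuts.h := by exact_mod_cast this
      change H ≤ ((s.cuts.discard j).h : ℝ) at hth
      linarith
    | reset j hno hj hμ =>
      change H ≤ (s.cuts.h : ℝ) at hth
      linarith
    | add k a β j z' hμ hk hrej hne ha hβ hγ hj hz' =>
      refine ⟨s, hs, hlt, ?_, hμ, Cuts.region_add_subset hj a β⟩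
      have : (s.cuts.add j a β).h = s.cuts.h + 1 := Finset.card_insert_of_notMem hj
      change H ≤ ((s.cuts.add j a β).h : ℝ) at hth
      rw [this] at hth
      exact_mod_cast hth

end Invariant

/-- The choice of the threshold for the number of cuts. -/
theorem exists_threshold {c : ℝ} (hc : 0 < c) :
    ∃ ν : ℝ, 0 < ν ∧ ∀ (n : ℕ) (R δ : ℝ) (h : ℕ), 2 ≤ n → 0 < δ → δ < R →
      2 ≤ ν * n * (Real.log n + Real.log (R / δ)) ∧
      ((h : ℝ) < ν * n * (Real.log n + Real.log (R / δ)) →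
        ν * n * (Real.log n + Real.log (R / δ)) ≤ h + 1 →
        (24 * h : ℝ) ^ n / √((1 + c) ^ h) < (innerRadius R δ / n) ^ n) := by
  set l := Real.log (1 + c) with hl
  have hl0 : 0 < l := Real.log_pos (by linarith)
  -- Chosen so that `w² l/4 > 15w > 11 + 4w`, the final comparison; `ν` is `w²`.
  set w := 60 / l + 2 with hw
  have hw2 : 2 < w := by
    have : 0 < 60 / l := by positivity
    linarith
  have hwl : 60 < w * l := by
    have : 60 / l * l = 60 := div_mul_cancel₀ _ hl0.ne'
    rw [hw]
    nlinarith
  refine ⟨w ^ 2, by positivity, fun n R δ h hn hδ hδR => ?_⟩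
  have hR : 0 < R := hδ.trans hδR
  have hn2 : (2 : ℝ) ≤ n := by exact_mod_cast hn
  have hn0 : (0 : ℝ) < n := by linarith
  have hlog2 : 0.69 < Real.log 2 := by linarith [Real.log_two_gt_d9]
  have hlogn : Real.log 2 ≤ Real.log n := Real.log_le_log (by norm_num) hn2
  have hlogR : 0 ≤ Real.log (R / δ) := Real.log_nonneg (by rw [le_div_iff₀ hδ]; linarith)
  set u := Real.log n + Real.log (R / δ) with hu
  have hu0 : 0.69 < u := by linarith
  have hH2 : 2 ≤ w ^ 2 * n * u := by
    have h1 : 4 ≤ w ^ 2 := by nlinarith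
    have h2 : 4 * 2 ≤ w ^ 2 * n := mul_le_mul h1 hn2 (by norm_num) (by positivity)
    nlinarith
  refine ⟨hH2, fun hlt hle => ?_⟩
  set H := w ^ 2 * n * u with hH
  have hh0 : (0 : ℝ) < h := by linarith
  have hr : 0 < innerRadius R δ := by unfold innerRadius; positivity
  have hc1 : 0 < 1 + c := by linarith
  rw [← Real.log_lt_log_iff (by positivity) (by positivity), Real.log_div (by positivity)
    (by positivity), Real.log_sqrt (by positivity), Real.log_pow, Real.log_pow, Real.log_pow, ← hl]
  have h24 : Real.log 24 ≤ 5 * u := by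
    have h1 : Real.log 24 ≤ Real.log (2 ^ 5) := Real.log_le_log (by norm_num) (by norm_num)
    rw [Real.log_pow] at h1
    push_cast at h1
    linarith
  have hlogw : Real.log w ≤ w := by linarith [Real.log_le_sub_one_of_pos (by linarith : 0 < w)]
  have hlogu : Real.log u ≤ u := by linarith [Real.log_le_sub_one_of_pos (by linarith : 0 < u)]
  have hlogh : Real.log (24 * h) ≤ 7 * u + 4 * (w * u) := by
    have h1 : Real.log h ≤ Real.log H := Real.log_le_log hh0 hlt.le
    rw [hH, Real.log_mul (by positivity) (by linarith), Real.log_mul (by positivity) hn0.ne',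
      Real.log_pow] at h1
    push_cast at h1
    rw [Real.log_mul (by norm_num) hh0.ne']
    nlinarith
  have hlogr : -(4 * u) ≤ Real.log (innerRadius R δ / n) := by
    have e : innerRadius R δ / n = (5 / 2 * (R / δ) * n)⁻¹ := by
      rw [innerRadius]
      field_simp
    rw [e, Real.log_inv, Real.log_mul (by positivity) hn0.ne', Real.log_mul (by norm_num)
      (by positivity)]
    have := Real.log_le_sub_one_of_pos (by norm_num : (0 : ℝ) < 5 / 2)
    linarith
  have hmain : n * (11 * u + 4 * (w * u)) < h * l / 2 := by
    -- From `h ≥ H - 1` and `H ≥ 2`.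
    have h1 : H / 2 ≤ h := by linarith
    have h2 : H / 2 * l ≤ h * l := mul_le_mul_of_nonneg_right h1 hl0.le
    have h3 : 11 + 4 * w < w ^ 2 * l / 4 := by nlinarith
    have h4 : (11 + 4 * w) * (n * u) < w ^ 2 * l / 4 * (n * u) :=
      mul_lt_mul_of_pos_right h3 (by positivity)
    have h5 : H / 2 * l = 2 * (w ^ 2 * l / 4 * (n * u)) := by rw [hH]; ring
    linarith
  have h6 := mul_le_mul_of_nonneg_left hlogh hn0.le
  have h7 := mul_le_mul_of_nonneg_left hlogr hn0.le
  linarith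

end CuttingPlane

end

/-! ### The theorem -/

theorem mainTheorem2 :
    ∃ u : ℕ → ℝ → ℝ → ℝ,
      (∃ c₁ c₂ : ℝ, 0 < c₁ ∧ 0 < c₂ ∧
        ∀ (n : ℕ) (R δ : ℝ), 2 ≤ n → 0 < δ → δ < R →
          c₁ * (Real.log n + Real.log (R / δ)) ≤ u n R δ ∧
            u n R δ ≤ c₂ * (Real.log n + Real.log (R / δ))) ∧
      ∀ C : CuttingPlane.Constants,
        ∃ ν : ℝ, 0 < ν ∧
          ∀ (n : ℕ) (R δ : ℝ) (K : Set (CuttingPlane.Vec n)) (p : CuttingPlane.Vec n),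
            2 ≤ n → 0 < δ → δ < R →
            Convex ℝ K → 0 ∈ interior K → K ⊆ Metric.closedBall 0 R →
            p ≠ 0 → ‖p‖ ≤ R →
            (p ∉ CuttingPlane.nbhd K δ →
              ENNReal.ofReal ((CuttingPlane.innerRadius R δ / n) ^ n) ≤
                  volume (CuttingPlane.robustSepCone K p δ) ∧
                ENNReal.ofReal ((CuttingPlane.innerRadius R δ / n) ^ n) ≤
                  volume (CuttingPlane.sepCone K p)) ∧
            ∀ s : CuttingPlane.State n,
              CuttingPlane.Reachable C K R δ p (ν * n * u n R δ) s →
              ν * n * u n R δ ≤ (s.cuts.h : ℝ) →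
              s.cuts.region ⊆
                  CuttingPlane.ellipsoid (s.cuts.hess s.z) s.z (6 * (s.cuts.h : ℝ)) ∧
                volume s.cuts.region <
                  ENNReal.ofReal ((CuttingPlane.innerRadius R δ / n) ^ n) ∧
                CuttingPlane.robustSepCone K p δ ⊆ s.cuts.region ∧
                p ∈ CuttingPlane.nbhd K δ := by
  refine ⟨fun n R δ => Real.log n + Real.log (R / δ),
    ⟨1, 1, one_pos, one_pos, fun n R δ _ _ _ => ⟨by rw [one_mul], by rw [one_mul]⟩⟩, fun C => ?_⟩
  have hγ := C.γ₀_pos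
  have hσ := C.σ₀_pos
  obtain ⟨c, hc, hc3, hcσ, hcγ⟩ : ∃ c : ℝ, 0 < c ∧ c ≤ 3 ∧ 4 * c ≤ C.σ₀ ∧
      4 * c * (1 + 7 * C.γ₀) ^ 2 ≤ C.γ₀ ^ 2 := by
    -- The three terms make the growth factor valid for the initial cut, for a reset cut and for an
    -- added cut; `1 + 7γ₀` bounds the growth of the new slack under recentring.
    refine ⟨min 3 (min (C.σ₀ / 4) (C.γ₀ ^ 2 / (4 * (1 + 7 * C.γ₀) ^ 2))), by positivity,
      min_le_left _ _, ?_, ?_⟩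
    · have := (min_le_right 3 (min (C.σ₀ / 4) (C.γ₀ ^ 2 / (4 * (1 + 7 * C.γ₀) ^ 2)))).trans
        (min_le_left _ _)
      linarith
    · have := (min_le_right 3 (min (C.σ₀ / 4) (C.γ₀ ^ 2 / (4 * (1 + 7 * C.γ₀) ^ 2)))).trans
        (min_le_right _ _)
      rw [le_div_iff₀ (by positivity)] at this
      linarith
  obtain ⟨ν, hν, hthr⟩ := CuttingPlane.exists_threshold hc
  refine ⟨ν, hν, fun n R δ K p hn hδ hδR hK h0 hKR hp hpR => ?_⟩
  have h0K : (0 : CuttingPlane.Vec n) ∈ K := interior_subset h0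
  have hvol := CuttingPlane.le_volume_robustSepCone (p := p) hn hδ hδR hK ⟨0, h0K⟩ hKR hpR
  refine ⟨fun hpK => ⟨hvol hpK,
    (hvol hpK).trans (measure_mono (CuttingPlane.robustSepCone_subset_sepCone hδ))⟩,
    fun s hs hh => ?_⟩
  beta_reduce at hs hh
  have hH2 := (hthr n R δ 0 hn hδ hδR).1
  have hinv := hs.invariant hδ hδR h0K hKR hp hpR hc hc3 hcσ hcγ
  obtain ⟨t, ht, hlt, hle, hμ, hsub⟩ := hs.exists_last_add (by linarith) hh
  have htinv := ht.invariant hδ hδR h0K hKR hp hpR hc hc3 hcσ hcγ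
  have hpos : 0 < (CuttingPlane.innerRadius R δ / n) ^ n := by
    have hR : 0 < R := hδ.trans hδR
    have : (0 : ℝ) < n := by exact_mod_cast (by omega : 0 < n)
    unfold CuttingPlane.innerRadius
    positivity
  have hsmall : volume s.cuts.region <
      ENNReal.ofReal ((CuttingPlane.innerRadius R δ / n) ^ n) := by
    refine ((measure_mono hsub).trans (htinv.volume_region_le hc.le ?_ hμ)).trans_lt
      ((ENNReal.ofReal_lt_ofReal_iff hpos).2 ((hthr n R δ t.cuts.h hn hδ hδR).2 hlt hle))
    have : (1 : ℝ) ≤ t.cuts.h := by linarith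
    exact_mod_cast this
  refine ⟨hinv.region_subset_ellipsoid ?_, hsmall, hinv.robustSepCone_subset, ?_⟩
  · have : (1 : ℝ) ≤ s.cuts.h := by linarith
    exact_mod_cast this
  · by_contra hpK
    exact absurd ((hvol hpK).trans (measure_mono hinv.robustSepCone_subset)) (not_le.2 hsmall)
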